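/- **Notation.** $L^p$ is the Lebesgue space of the unit circle $\mathbb T$ with normalized arc-length measure $m$, and $H^p\subseteq L^p$ is the Hardy space, whose elements are identified with holomorphic functions on the unit disk $\mathbb D$. Inner products are linear in the first variable. A function $g\in H^2$ is *outer* if $H^\infty g$ is dense in $H^2$. Let $\mathcal A$ be a unital weak$^*$-closed subalgebra of $H^\infty$. Let $L^\infty(\mathcal A)$ be the smallest weak$^*$-closed subalgebra of $L^\infty$ containing $\mathcal A+\overline{\mathcal A}$; it equals $L^\infty(\mathbb T,\mathcal M,m)$, where $\mathcal M$ is the $\sigma$-algebra of the measurable sets whose indicator function lies in $L^\infty(\mathcal A)$, and $L^2(\mathcal A)$ denotes $L^2(\mathbb T,\mathcal M,m)$. For $g\in H^2$ let $\mathcal H_g=[\mathcal A g]$ be the closure of $\mathcal A g$ in $H^2$, and let $K_g:\mathbb D\times\mathbb D\to\mathbb C$ be its reproducing kernel. Let $C(\mathcal A)$ (columns) and $R(\mathcal A)$ (rows) both denote the set of functions $F=(f_k)_{k\ge1}:\mathbb D\to\ell^2$ with $f_k\in\mathcal A$ for all $k$ and $\sup_{z\in\mathbb D}\|F(z)\|_{\ell^2}<\infty$.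 For $F\in R(\mathcal A)$ let $M_{F,g}\in B(\mathcal H_g\otimes\ell^2,\mathcal H_g)$ be the operator $(h_k)_k\mapsto\sum_k f_kh_k$, where $\mathcal H_g\otimes\ell^2$ is identified with the $\ell^2$-direct sum of copies of $\mathcal H_g$. **Statement.** Let $\mathcal A$ be a unital weak$^*$-closed subalgebra of $H^\infty$. 1. Let $x_1,\dots,x_n\in\mathbb D$, $v_1,\dots,v_n\in\ell^2$, $w_1,\dots,w_n\in\mathbb C$ and $\alpha\ge0$. There exists $F\in C(\mathcal A)$ such that $\sup_{z\in\mathbb D}\|F(z)\|_{\ell^2}\le\alpha$ and $\langle v_j,F(x_j)\rangle=\overline{w_j}$ for $j=1,\dots,n$ if and only if the matrix $$Q_g=\bigl[(\alpha^2\langle v_j,v_i\rangle-w_i\overline{w_j})\,K_g(x_i,x_j)\bigr]_{i,j=1}^n$$ is positive semidefinite for all outer functions $g$ such that $|g|\in L^2(\mathcal A)$ and $\|g\|_2=1$. 2. Let $F\in R(\mathcal A)$. If there is a constant $\delta>0$ such that $M_{F,g}M_{F,g}^*\ge\delta^2 I$ on $\mathcal H_g$ for all outer functions $g$ such that $|g|\in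 L^2(\mathcal A)$ and $\|g\|_2=1$, then there exists $G\in C(\mathcal A)$ such that $FG=1$, that is, $\sum_k f_k(z)g_k(z)=1$ for all $z\in\mathbb D$ where $G=(g_k)_k$, and $\sup_{z\in\mathbb D}\|G(z)\|_{\ell^2}\le\delta^{-1}$. -/

import Mathlib

open MeasureTheory AddCircle ComplexConjugate
open scoped ENNReal Topology ComplexOrder InnerProduct

noncomputable section

/-- The unit circle, parametrized by `t ↦ exp (2 π i t)`, `t ∈ ℝ / ℤ`. -/
abbrev Circ : Type := UnitAddCircle

/-- Normalized arc-length measure on the circle. -/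
abbrev arc : Measure Circ := haarAddCircle

/-- The Lebesgue space `L^p` of the circle. -/
abbrev LSp (p : ℝ≥0∞) : Type := Lp ℂ p arc

/-- The open unit disk. -/
abbrev Disk : Type := Complex.UnitDisc

/-- The Hilbert space `ℓ²(ℕ)`. -/
abbrev ell2 : Type := lp (fun _ : ℕ => ℂ) 2

/-- The pointwise product `f h` of `f ∈ L^∞` and `h ∈ L^p`. -/
def lpMul (p : ℝ≥0∞) [Fact (1 ≤ p)] : LSp ⊤ →L[ℂ] LSp p →L[ℂ] LSp p :=
  (ContinuousLinearMap.mul ℂ ℂ).holderL arc ⊤ p p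

/-- The constant function `1` in `L^∞`. -/
def oneInf : LSp ⊤ := (memLp_const (1 : ℂ)).toLp (fun _ => (1 : ℂ))

theorem lpMul_coe (p : ℝ≥0∞) [Fact (1 ≤ p)] (f : LSp ⊤) (h : LSp p) :
    (lpMul p f h : Circ → ℂ) =ᵐ[arc] fun t => f t * h t :=
  (ContinuousLinearMap.mul ℂ ℂ).coeFn_holder f h

theorem lpMul_assoc (p : ℝ≥0∞) [Fact (1 ≤ p)] (f g : LSp ⊤) (h : LSp p) :
    lpMul p f (lpMul p g h) = lpMul p (lpMul ⊤ f g) h := by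
  apply Lp.ext
  filter_upwards [lpMul_coe p f (lpMul p g h), lpMul_coe p g h,
    lpMul_coe p (lpMul ⊤ f g) h, lpMul_coe ⊤ f g] with t h1 h2 h3 h4
  rw [h1, h2, h3, h4, mul_assoc]

theorem lsp_integrable {p : ℝ≥0∞} [hp : Fact (1 ≤ p)] (f : LSp p) : Integrable f arc :=
  (Lp.memLp f).integrable hp.out

/-- The Hardy space `H^p`: functions in `L^p` of the circle whose Fourier coefficients of
negative index vanish. -/
def hardy (p : ℝ≥0∞) [hp : Fact (1 ≤ p)] : Submodule ℂ (LSp p) where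
  carrier := {f | ∀ n : ℤ, n < 0 → fourierCoeff (f : Circ → ℂ) n = 0}
  zero_mem' := fun n _ => by
    rw [fourierCoeff_congr_ae (Lp.coeFn_zero ℂ p arc)]
    simp [fourierCoeff]
  add_mem' := fun {f g} hf hg n hn => by
    rw [fourierCoeff_congr_ae (Lp.coeFn_add f g),
      fourierCoeff.add (lsp_integrable f) (lsp_integrable g),
      Pi.add_apply, hf n hn, hg n hn, add_zero]
  smul_mem' := fun c f hf n hn => by
    rw [fourierCoeff_congr_ae (Lp.coeFn_smul c f), fourierCoeff.const_smul, hf n hn, smul_zero]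

/-- The Hardy space `H²`. -/
abbrev H2 : Type := hardy 2

theorem fourierCoeff_eq_inner (f : LSp 2) (n : ℤ) :
    fourierCoeff (f : Circ → ℂ) n = inner ℂ (fourierLp 2 n : LSp 2) f := by
  rw [← fourierBasis_repr, HilbertBasis.repr_apply_apply, coe_fourierBasis]

theorem norm_fourierCoeff_le (f : LSp 2) (n : ℤ) : ‖fourierCoeff (f : Circ → ℂ) n‖ ≤ ‖f‖ := by
  rw [fourierCoeff_eq_inner]
  refine (norm_inner_le_norm _ _).trans ?_
  rw [(orthonormal_fourier (T := 1)).1 n, one_mul]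

theorem isClosed_hardy_two : IsClosed (hardy 2 : Set (LSp 2)) := by
  have : (hardy 2 : Set (LSp 2)) =
      ⋂ n : ℤ, ⋂ _ : n < 0, {f | inner ℂ (fourierLp 2 n : LSp 2) f = 0} := by
    ext f
    simp only [Set.mem_iInter, Set.mem_ofPred_eq, ← fourierCoeff_eq_inner]
    rfl
  rw [this]
  refine isClosed_iInter fun n => isClosed_iInter fun _ => ?_
  exact isClosed_eq (by fun_prop) continuous_const

/-- The value at `z` in the disk of the holomorphic function `∑ f̂(n) zⁿ` whose boundary function
is `f ∈ H^p`. -/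
def diskEval (f : Circ → ℂ) (z : Disk) : ℂ := ∑' n : ℕ, fourierCoeff f n * (z : ℂ) ^ n

theorem summable_diskEval (f : LSp 2) (z : Disk) :
    Summable fun n : ℕ => fourierCoeff (f : Circ → ℂ) n * (z : ℂ) ^ n := by
  refine Summable.of_norm_bounded
    (g := fun n : ℕ => ‖f‖ * ‖(z : ℂ)‖ ^ n) ?_ fun n => ?_
  · exact (summable_geometric_of_lt_one (norm_nonneg _) z.norm_lt_one).mul_left _
  · rw [norm_mul, norm_pow]
    gcongr
    exact norm_fourierCoeff_le f n

theorem norm_diskEval_le (f : LSp 2) (z : Disk) :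
    ‖diskEval f z‖ ≤ (1 - ‖(z : ℂ)‖)⁻¹ * ‖f‖ := by
  have hs := (summable_geometric_of_lt_one (norm_nonneg _) z.norm_lt_one).mul_left ‖f‖
  refine (tsum_of_norm_bounded hs.hasSum fun n => ?_).trans_eq ?_
  · rw [norm_mul, norm_pow]
    gcongr
    exact norm_fourierCoeff_le f n
  · rw [tsum_mul_left, tsum_geometric_of_lt_one (norm_nonneg _) z.norm_lt_one, mul_comm]

/-- Evaluation at a point of the disk, as a bounded functional. -/
def evalCLM (z : Disk) : LSp 2 →L[ℂ] ℂ :=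
  LinearMap.mkContinuous
    { toFun := fun f => diskEval f z
      map_add' := fun f g => by
        simp only [diskEval, fourierCoeff_eq_inner, inner_add_right, add_mul]
        have h1 := summable_diskEval f z
        have h2 := summable_diskEval g z
        simp only [fourierCoeff_eq_inner] at h1 h2
        exact h1.tsum_add h2
      map_smul' := fun c f => by
        simp only [diskEval, fourierCoeff_eq_inner, inner_smul_right,
          mul_assoc, tsum_mul_left, smul_eq_mul, RingHom.id_apply] }
    (1 - ‖(z : ℂ)‖)⁻¹ (fun f => norm_diskEval_le f z)

/-- An element of `H²` is determined by its values on the disk. -/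
theorem eq_zero_of_diskEval {u : LSp 2} (hu : u ∈ hardy 2) (h0 : ∀ z, diskEval u z = 0) :
    u = 0 := by
  set a : ℕ → ℂ := fun n => fourierCoeff (u : Circ → ℂ) n with ha
  have hps : HasFPowerSeriesAt (fun _ : ℂ => (0 : ℂ)) (FormalMultilinearSeries.ofScalars ℂ a) 0 := by
    refine ⟨1, ⟨?_, by norm_num, fun {y} hy => ?_⟩⟩
    · refine FormalMultilinearSeries.le_radius_of_bound _ ‖u‖ (r := 1) fun n => ?_
      simp only [FormalMultilinearSeries.ofScalars_norm]
      simpa using norm_fourierCoeff_le u n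
    · have hy' : ‖y‖ < 1 := by
        simpa [Metric.mem_eball, edist_zero_right, enorm_eq_nnnorm, ← NNReal.coe_lt_coe] using hy
      have := (summable_diskEval u (Complex.UnitDisc.mk y hy')).hasSum
      rw [← diskEval, h0] at this
      simpa [FormalMultilinearSeries.ofScalars_apply_eq, mul_comm] using this
  have hz := hps.eq_zero
  have ha0 : ∀ n, a n = 0 := fun n => by
    have := congrFun hz n
    have h2 : ‖FormalMultilinearSeries.ofScalars ℂ a n‖ = 0 := by rw [this]; simp
    simpa [FormalMultilinearSeries.ofScalars_norm] using h2
  have hall : ∀ n : ℤ, fourierCoeff (u : Circ → ℂ) n = 0 := fun n => by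
    rcases lt_or_ge n 0 with hn | hn
    · exact hu n hn
    · obtain ⟨m, rfl⟩ := Int.eq_ofNat_of_zero_le hn
      exact ha0 m
  apply (fourierBasis (T := 1)).repr.injective
  ext n
  rw [fourierBasis_repr, hall n]
  simp

/-- The product of `f ∈ H^∞` and `h ∈ H²` is in `H²`. -/
theorem lpMul_mem_hardy {f : LSp ⊤} (hf : f ∈ hardy ⊤) {h : LSp 2} (hh : h ∈ hardy 2) :
    lpMul 2 f h ∈ hardy 2 := by
  intro n hn
  have key : ∀ k : ℤ, inner ℂ (fourierLp 2 n : LSp 2) (lpMul 2 f (fourierLp 2 k)) =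
      fourierCoeff (f : Circ → ℂ) (n - k) := fun k => by
    rw [← fourierCoeff_eq_inner]
    refine integral_congr_ae ?_
    filter_upwards [lpMul_coe 2 f (fourierLp 2 k), coeFn_fourierLp (T := 1) 2 k] with t h1 h2
    rw [h1, h2, neg_sub, sub_eq_add_neg, fourier_add, smul_eq_mul, smul_eq_mul]
    ring
  have hs := (hasSum_fourier_series_L2 (T := 1) h).mapL
    ((innerSL ℂ (fourierLp 2 n : LSp 2)).comp (lpMul 2 f))
  have hz : ∀ k : ℤ, ((innerSL ℂ (fourierLp 2 n : LSp 2)).comp (lpMul 2 f))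
      (fourierCoeff (h : Circ → ℂ) k • fourierLp 2 k) = 0 := fun k => by
    rw [map_smul]
    rcases lt_or_ge k 0 with hk | hk
    · rw [hh k hk, zero_smul]
    · change _ • inner ℂ (fourierLp 2 n : LSp 2) (lpMul 2 f (fourierLp 2 k)) = 0
      rw [key, hf (n - k) (by omega), smul_zero]
  simp only [hz] at hs
  rw [fourierCoeff_eq_inner]
  exact hs.unique hasSum_zero

/-- The closed subspace `[S g]` of `L²` generated by the products `f g`, `f ∈ S`. It lies in `H²`
if `S ⊆ H^∞` and `g ∈ H²`. -/
def cyclic (S : Set (LSp ⊤)) (g : LSp 2) : Submodule ℂ (LSp 2) :=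
  (Submodule.span ℂ {h | ∃ f ∈ S, h = lpMul 2 f g}).topologicalClosure

instance completeSpace_cyclic (S : Set (LSp ⊤)) (g : LSp 2) : CompleteSpace (cyclic S g) :=
  inferInstanceAs (CompleteSpace (Submodule.topologicalClosure _))

theorem cyclic_le_hardy {S : Set (LSp ⊤)} (hS : S ⊆ hardy ⊤) {g : LSp 2} (hg : g ∈ hardy 2) :
    cyclic S g ≤ hardy 2 := by
  refine Submodule.topologicalClosure_minimal _ (Submodule.span_le.2 ?_) isClosed_hardy_two
  rintro _ ⟨f, hf, rfl⟩
  exact lpMul_mem_hardy (hS hf) hg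

/-- `g ∈ H²` is outer if the closure of `H^∞ g` is `H²`. -/
def IsOuter (g : H2) : Prop := cyclic (hardy ⊤ : Set (LSp ⊤)) g = hardy 2

/-- The weak-star topology of `L^∞`, the dual space of `L¹`. -/
@[reducible] def weakStar : TopologicalSpace (LSp ⊤) :=
  TopologicalSpace.induced
    (fun f => StrongDual.toWeakDual
      ((ContinuousLinearMap.mul ℂ ℂ).lpPairing arc ⊤ 1 f : StrongDual ℂ (LSp 1)))
    inferInstance

/-- A linear subspace of `L^∞` that is a unital subalgebra. -/
def IsUnitalSubalg (B : Submodule ℂ (LSp ⊤)) : Prop :=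
  oneInf ∈ B ∧ ∀ f ∈ B, ∀ g ∈ B, lpMul ⊤ f g ∈ B

/-- A unital weak-star closed subalgebra of `H^∞`. -/
structure HinfSubalg where
  carrier : Submodule ℂ (LSp ⊤)
  le_hardy : carrier ≤ hardy ⊤
  unital_subalg : IsUnitalSubalg carrier
  closed : IsClosed[weakStar] (carrier : Set (LSp ⊤))

namespace HinfSubalg

variable (A : HinfSubalg)

/-- `L^∞(A)`: the smallest weak-star closed subalgebra of `L^∞` that contains `A` and the complex
conjugates of the elements of `A`. -/
def LinfGen : Submodule ℂ (LSp ⊤) :=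
  sInf {B | IsUnitalSubalg B ∧ IsClosed[weakStar] (B : Set (LSp ⊤)) ∧
    ∀ f ∈ A.carrier, f ∈ B ∧ star f ∈ B}

/-- The σ-algebra of `A`: it is generated by (in fact, consists of) the measurable sets whose
indicator function is in `L^∞(A)`. -/
@[reducible] def sigma : MeasurableSpace Circ :=
  MeasurableSpace.generateFrom {E | MeasurableSet E ∧
    ∃ f ∈ A.LinfGen, (f : Circ → ℂ) =ᵐ[arc] E.indicator fun _ => 1}

/-- `φ ∈ L^p(A)`: `φ` is in `L^p` and agrees almost everywhere with a function that is measurable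
for the σ-algebra of `A`. -/
def MemLpGen (p : ℝ≥0∞) (φ : Circ → ℝ) : Prop :=
  MemLp φ p arc ∧ AEStronglyMeasurable[A.sigma] φ arc

/-- The outer functions `g` such that `|g| ∈ L²(A)` and `‖g‖₂ = 1`. -/
def Admissible (g : H2) : Prop :=
  IsOuter g ∧ A.MemLpGen 2 (fun t => ‖(g : LSp 2) t‖) ∧ ‖g‖ = 1

/-- The space `H_g = [A g]`. -/
abbrev Hg (g : H2) : Submodule ℂ (LSp 2) := cyclic (A.carrier : Set (LSp ⊤)) g

/-- `H_g` is, through evaluation at points of the disk, a reproducing kernel Hilbert space. -/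
instance rkhsHg (g : H2) : RKHS ℂ (A.Hg g) Disk ℂ where
  coeCLM := ContinuousLinearMap.pi fun z => (evalCLM z).comp (A.Hg g).subtypeL
  coeCLM_injective := fun f f' h => by
    have hd : ((f - f' : A.Hg g) : LSp 2) = 0 := by
      refine eq_zero_of_diskEval (cyclic_le_hardy A.le_hardy g.2 (f - f').2) fun z => ?_
      have h1 : evalCLM z (f : LSp 2) = evalCLM z (f' : LSp 2) := congrFun h z
      change evalCLM z ((f - f' : A.Hg g) : LSp 2) = 0
      rw [Submodule.coe_sub, map_sub, h1, sub_self]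
    exact sub_eq_zero.1 (Subtype.ext hd)

/-- The reproducing kernel `K_g` of `H_g`. -/
def kernel (g : H2) (x y : Disk) : ℂ := RKHS.kernel (A.Hg g) x y 1

/-- Sequences `(f_k)` of elements of `A` such that `F(z) = (f_k(z))` is in `ℓ²` for all `z` in the
disk and `sup_z ‖F(z)‖ < ∞`. -/
structure BddSeq where
  comp : ℕ → LSp ⊤
  mem : ∀ k, comp k ∈ A.carrier
  memℓp : ∀ z : Disk, Memℓp (fun k => diskEval (comp k) z) 2
  bdd : BddAbove (Set.range fun z : Disk => ‖(⟨fun k => diskEval (comp k) z, memℓp z⟩ : ell2)‖)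

/-- `C(A)`: such sequences, viewed as columns. -/
abbrev Col : Type := A.BddSeq

/-- `R(A)`: such sequences, viewed as rows. -/
abbrev Row : Type := A.BddSeq

end HinfSubalg

/-- The `ℓ²`-valued function `F` on the disk. -/
def HinfSubalg.BddSeq.val {A : HinfSubalg} (F : A.BddSeq) (z : Disk) : ell2 :=
  ⟨fun k => diskEval (F.comp k) z, F.memℓp z⟩


theorem summable_natAbs_pow {r : ℝ} (h0 : 0 ≤ r) (h1 : r < 1) :
    Summable fun n : ℤ => r ^ n.natAbs := by
  apply Summable.of_nat_of_neg <;> simpa using summable_geometric_of_lt_one h0 h1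

/-- The point `r e^{2πit}` of the disk. -/
def diskPt (r : ℝ) (h0 : 0 ≤ r) (h1 : r < 1) (t : Circ) : Disk :=
  Complex.UnitDisc.mk (r * fourier 1 t) (by
    rw [norm_mul, fourier_apply, Circle.norm_coe, mul_one, Complex.norm_real,
      Real.norm_of_nonneg h0]
    exact h1)

theorem exists_dilate (f : LSp 2) (hf : f ∈ hardy 2) (r : ℝ) (h0 : 0 ≤ r) (h1 : r < 1) :
    ∃ g : LSp 2, (∀ n, fourierCoeff (g : Circ → ℂ) n =
        fourierCoeff (f : Circ → ℂ) n * (r : ℂ) ^ n.natAbs) ∧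
      ∀ᵐ t ∂arc, g t = diskEval f (diskPt r h0 h1 t) := by
  set b : ℤ → ℂ := fun n => fourierCoeff (f : Circ → ℂ) n * (r : ℂ) ^ n.natAbs with hb
  have hbs : Summable fun n => ‖b n‖ := by
    refine Summable.of_nonneg_of_le (fun _ => norm_nonneg _) (fun n => ?_)
      ((summable_natAbs_pow h0 h1).mul_left ‖f‖)
    rw [hb, norm_mul, norm_pow, Complex.norm_real, Real.norm_of_nonneg h0]
    gcongr
    exact norm_fourierCoeff_le f n
  have hcs : Summable fun n : ℤ => (b n • fourier n : C(Circ, ℂ)) := by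
    refine Summable.of_norm ?_
    simpa only [norm_smul, fourier_norm, mul_one] using hbs
  have hbm : Memℓp b 2 := by
    have h1' : Memℓp b 1 := memℓp_gen (by simpa using hbs)
    exact h1'.of_exponent_ge (by norm_num)
  set D : C(Circ, ℂ) := ∑' n : ℤ, (b n • fourier n : C(Circ, ℂ)) with hD
  have hL2 : HasSum (fun n : ℤ => b n • (fourierLp 2 n : LSp 2))
      (ContinuousMap.toLp 2 arc ℂ D) := by
    have := hcs.hasSum.mapL (ContinuousMap.toLp (E := ℂ) 2 arc ℂ)
    simpa only [map_smul] using this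
  have hrepr : ContinuousMap.toLp (E := ℂ) 2 arc ℂ D =
      (fourierBasis (T := 1)).repr.symm ⟨b, hbm⟩ := by
    refine hL2.unique ?_
    have := (fourierBasis (T := 1)).hasSum_repr_symm ⟨b, hbm⟩
    simpa only [coe_fourierBasis] using this
  refine ⟨ContinuousMap.toLp (E := ℂ) 2 arc ℂ D, fun n => ?_, ?_⟩
  · rw [← fourierBasis_repr, hrepr, LinearIsometryEquiv.apply_symm_apply]
  · filter_upwards [ContinuousMap.coeFn_toLp (E := ℂ) (p := 2) (𝕜 := ℂ) arc D] with t ht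
    rw [ht]
    have hev : HasSum (fun n : ℤ => b n * fourier n t) (D t) := by
      have := hcs.hasSum.mapL (ContinuousMap.evalCLM ℂ t)
      simpa using this
    have hinj : Function.Injective ((↑) : ℕ → ℤ) := Nat.cast_injective
    have hN : HasSum (fun n : ℕ => b n * fourier (n : ℤ) t) (D t) := by
      refine (hinj.hasSum_iff (f := fun n : ℤ => b n * fourier n t) fun n hn => ?_).2 hev
      have hneg : n < 0 := by
        by_contra h
        exact hn ⟨n.toNat, by simp at h ⊢; omega⟩
      simp only [hb]
      rw [hf n hneg, zero_mul, zero_mul]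
    rw [← hN.tsum_eq, diskEval]
    refine tsum_congr fun n => ?_
    have h3 : (fourier (n : ℤ) t : ℂ) = (fourier 1 t : ℂ) ^ n := by
      simp [fourier_apply, AddCircle.toCircle_nsmul]
    rw [h3]
    simp [hb, diskPt, mul_pow, mul_assoc]

theorem tendsto_of_coeff (f : LSp 2) (g : ℕ → LSp 2) (r : ℕ → ℝ) (hr0 : ∀ j, 0 ≤ r j)
    (hr1 : ∀ j, r j ≤ 1) (hr : Filter.Tendsto r Filter.atTop (𝓝 1))
    (hg : ∀ j n, fourierCoeff (g j : Circ → ℂ) n =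
      fourierCoeff (f : Circ → ℂ) n * (r j : ℂ) ^ n.natAbs) :
    Filter.Tendsto g Filter.atTop (𝓝 f) := by
  set e := (fourierBasis (T := 1)).repr
  have hnorm : ∀ u : LSp 2, ‖u‖ ^ 2 = ∑' n : ℤ, ‖fourierCoeff (u : Circ → ℂ) n‖ ^ 2 := fun u => by
    have := lp.norm_rpow_eq_tsum (p := 2) (by norm_num) (e u)
    rw [LinearIsometryEquiv.norm_map] at this
    simpa [e, fourierBasis_repr] using this
  have hsum : Summable fun n : ℤ => ‖fourierCoeff (f : Circ → ℂ) n‖ ^ 2 := by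
    have := (lp.memℓp (e f)).summable (by norm_num)
    simpa [e, fourierBasis_repr] using this
  have hsub : ∀ j n, fourierCoeff ((g j - f : LSp 2) : Circ → ℂ) n =
      fourierCoeff (f : Circ → ℂ) n * ((r j : ℂ) ^ n.natAbs - 1) := fun j n => by
    rw [fourierCoeff_eq_inner, inner_sub_right, ← fourierCoeff_eq_inner, ← fourierCoeff_eq_inner,
      hg]
    ring
  rw [tendsto_iff_norm_sub_tendsto_zero]
  have h2 : Filter.Tendsto (fun j => ‖g j - f‖ ^ 2) Filter.atTop (𝓝 0) := by
    simp only [hnorm, hsub]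
    rw [← tsum_zero (α := ℝ) (β := ℤ)]
    refine tendsto_tsum_of_dominated_convergence hsum (fun n => ?_)
      (Filter.Eventually.of_forall fun j n => ?_)
    · have : Filter.Tendsto (fun j => ‖fourierCoeff (f : Circ → ℂ) n *
          ((r j : ℂ) ^ n.natAbs - 1)‖ ^ 2) Filter.atTop
          (𝓝 (‖fourierCoeff (f : Circ → ℂ) n * (((1 : ℝ) : ℂ) ^ n.natAbs - 1)‖ ^ 2)) := by
        have hrc := (Complex.continuous_ofReal.tendsto 1).comp hr
        exact ((((hrc.pow n.natAbs).sub_const 1).const_mul _).norm).pow 2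
      simpa using this
    · rw [Real.norm_of_nonneg (by positivity), norm_mul]
      have hle : ‖(r j : ℂ) ^ n.natAbs - 1‖ ≤ 1 := by
        rw [← Complex.ofReal_pow, ← Complex.ofReal_one, ← Complex.ofReal_sub, Complex.norm_real,
          Real.norm_eq_abs, abs_le]
        have a1 := pow_le_one₀ (n := n.natAbs) (hr0 j) (hr1 j)
        have a2 := pow_nonneg (hr0 j) n.natAbs
        constructor <;> linarith
      gcongr
      exact mul_le_of_le_one_right (norm_nonneg _) hle
  have h3 := h2.sqrt
  simpa [Real.sqrt_sq] using h3

/-- A bound for `∑ |f_k(z)|²` on the disk holds almost everywhere on the circle. -/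
theorem ae_sum_le {s : Finset ℕ} (f : ℕ → LSp 2) (hf : ∀ k, f k ∈ hardy 2) (C : ℝ)
    (hC : ∀ z : Disk, ∑ k ∈ s, ‖diskEval (f k) z‖ ^ 2 ≤ C) :
    ∀ᵐ t ∂arc, ∑ k ∈ s, ‖f k t‖ ^ 2 ≤ C := by
  set r : ℕ → ℝ := fun j => 1 - 1 / ((j : ℝ) + 1) with hrdef
  have hpos : ∀ j : ℕ, 0 < 1 / ((j : ℝ) + 1) := fun j => by positivity
  have hr0 : ∀ j, 0 ≤ r j := fun j => by
    have : 1 / ((j : ℝ) + 1) ≤ 1 := by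
      rw [div_le_one (by positivity)]; linarith [(Nat.cast_nonneg j : (0 : ℝ) ≤ j)]
    simp only [hrdef]; linarith
  have hr1 : ∀ j, r j < 1 := fun j => by simp only [hrdef]; linarith [hpos j]
  have hr : Filter.Tendsto r Filter.atTop (𝓝 1) := by
    simpa [hrdef] using (tendsto_one_div_add_atTop_nhds_zero_nat (𝕜 := ℝ)).const_sub 1
  choose g hgc hgv using fun k j => exists_dilate (f k) (hf k) (r j) (hr0 j) (hr1 j)
  have htend : ∀ k, Filter.Tendsto (g k) Filter.atTop (𝓝 (f k)) := fun k =>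
    tendsto_of_coeff (f k) (g k) r hr0 (fun j => (hr1 j).le) hr (hgc k)
  have hmeas : TendstoInMeasure arc
      (fun j => ∑ k ∈ s, fun t => ‖((g k j - f k : LSp 2) : Circ → ℂ) t‖) Filter.atTop
      (0 : Circ → ℝ) := by
    refine tendstoInMeasure_of_tendsto_eLpNorm (p := 2) (by norm_num) (fun j => ?_)
      aestronglyMeasurable_zero ?_
    · exact Finset.aestronglyMeasurable_sum _ fun k _ => (Lp.aestronglyMeasurable _).norm
    · simp only [sub_zero]
      have hz : Filter.Tendsto (fun j => ∑ k ∈ s, ‖(g k j - f k : LSp 2)‖ₑ) Filter.atTop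
          (𝓝 0) := by
        have h0 : (0 : ℝ≥0∞) = ∑ k ∈ s, 0 := by simp
        rw [h0]
        refine tendsto_finsetSum _ fun k _ => ?_
        have := (tendsto_iff_norm_sub_tendsto_zero.1 (htend k))
        have h4 := ENNReal.tendsto_ofReal this
        simpa [ofReal_norm] using h4
      refine tendsto_of_tendsto_of_tendsto_of_le_of_le tendsto_const_nhds hz
        (fun _ => zero_le) fun j => ?_
      refine (eLpNorm_sum_le (fun k _ => (Lp.aestronglyMeasurable _).norm) (by norm_num)).trans ?_
      refine Finset.sum_le_sum fun k _ => ?_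
      rw [eLpNorm_norm, Lp.enorm_def]
  obtain ⟨ns, -, hns⟩ := hmeas.exists_seq_tendsto_ae
  have hval : ∀ᵐ t ∂arc, ∀ k j, g k j t = diskEval (f k) (diskPt (r j) (hr0 j) (hr1 j) t) :=
    ae_all_iff.2 fun k => ae_all_iff.2 fun j => hgv k j
  have hsubv : ∀ᵐ t ∂arc, ∀ k j, ((g k j - f k : LSp 2) : Circ → ℂ) t = g k j t - f k t :=
    ae_all_iff.2 fun k => ae_all_iff.2 fun j => Lp.coeFn_sub _ _
  filter_upwards [hns, hval, hsubv] with t h1 h2 h3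
  have hk : ∀ k ∈ s, Filter.Tendsto (fun i => g k (ns i) t) Filter.atTop (𝓝 (f k t)) := by
    intro k hk
    rw [tendsto_iff_norm_sub_tendsto_zero]
    refine tendsto_of_tendsto_of_tendsto_of_le_of_le tendsto_const_nhds h1
      (fun _ => norm_nonneg _) fun i => ?_
    simp only [Finset.sum_apply]
    rw [← h3 k (ns i)]
    exact Finset.single_le_sum
      (f := fun k => ‖((g k (ns i) - f k : LSp 2) : Circ → ℂ) t‖) (fun _ _ => norm_nonneg _) hk
  have hlim : Filter.Tendsto (fun i => ∑ k ∈ s, ‖g k (ns i) t‖ ^ 2) Filter.atTop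
      (𝓝 (∑ k ∈ s, ‖f k t‖ ^ 2)) :=
    tendsto_finsetSum _ fun k hks => ((hk k hks).norm).pow 2
  refine le_of_tendsto hlim (Filter.Eventually.of_forall fun i => ?_)
  simp only [h2]
  exact hC _

theorem norm_sq_eq_integral (u : LSp 2) : ‖u‖ ^ 2 = ∫ t, ‖u t‖ ^ 2 ∂arc := by
  have h := L2.inner_def (𝕜 := ℂ) u u
  rw [inner_self_eq_norm_sq_to_K] at h
  have h2 : (fun t => inner ℂ (u t) (u t)) = fun t => ((‖u t‖ ^ 2 : ℝ) : ℂ) := by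
    funext t
    rw [inner_self_eq_norm_sq_to_K]
    push_cast
    rfl
  rw [h2, integral_complex_ofReal] at h
  exact Complex.ofReal_injective (by rw [← h]; push_cast; rfl)

theorem norm_row_le (s : Finset ℕ) (f : ℕ → LSp ⊤) (hf : ∀ k, f k ∈ hardy ⊤) (C : ℝ)
    (hC : ∀ z : Disk, ∑ k ∈ s, ‖diskEval (f k) z‖ ^ 2 ≤ C) (h : ℕ → LSp 2) :
    ‖∑ k ∈ s, lpMul 2 (f k) (h k)‖ ^ 2 ≤ C * ∑ k ∈ s, ‖h k‖ ^ 2 := by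
  have hm : ∀ k, MemLp (f k : Circ → ℂ) 2 arc := fun k =>
    (Lp.memLp (f k)).mono_exponent le_top
  have hae : ∀ᵐ t ∂arc, ∑ k ∈ s, ‖f k t‖ ^ 2 ≤ C := by
    have h1 := ae_sum_le (s := s) (fun k => (hm k).toLp _) (fun k n hn => by
      rw [fourierCoeff_congr_ae (hm k).coeFn_toLp]
      exact hf k n hn) C (fun z => by
      refine le_trans (le_of_eq ?_) (hC z)
      refine Finset.sum_congr rfl fun k _ => ?_
      have : fourierCoeff ((hm k).toLp (f k : Circ → ℂ) : Circ → ℂ) =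
          fourierCoeff (f k : Circ → ℂ) := fourierCoeff_congr_ae (hm k).coeFn_toLp
      simp only [diskEval, this])
    have h2 : ∀ᵐ t ∂arc, ∀ k, (hm k).toLp (f k : Circ → ℂ) t = f k t :=
      ae_all_iff.2 fun k => (hm k).coeFn_toLp
    filter_upwards [h1, h2] with t a b
    simpa only [b] using a
  have hint : ∀ u : LSp 2, Integrable (fun t => ‖u t‖ ^ 2) arc := fun u =>
    (Lp.memLp u).integrable_norm_pow (by norm_num)
  rw [norm_sq_eq_integral]
  simp only [norm_sq_eq_integral]
  rw [← integral_finsetSum _ fun k _ => hint (h k), ← integral_const_mul]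
  have hsum : ∀ᵐ t ∂arc, (∑ k ∈ s, lpMul 2 (f k) (h k) : LSp 2) t =
      ∑ k ∈ s, (lpMul 2 (f k) (h k) : LSp 2) t := by
    filter_upwards [Lp.coeFn_finsetSum s fun k => (lpMul 2 (f k) (h k) : LSp 2)] with t ht
    rw [ht, Finset.sum_apply]
  have hmul : ∀ᵐ t ∂arc, ∀ k, (lpMul 2 (f k) (h k) : LSp 2) t = f k t * h k t :=
    ae_all_iff.2 fun k => lpMul_coe 2 (f k) (h k)
  refine integral_mono_ae (hint _)
    ((integrable_finsetSum _ fun k _ => hint (h k)).const_mul C) ?_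
  filter_upwards [hae, hsum, hmul] with t a b c
  rw [b]
  simp only [c]
  calc ‖∑ k ∈ s, f k t * h k t‖ ^ 2 ≤ (∑ k ∈ s, ‖f k t‖ * ‖h k t‖) ^ 2 := by
        gcongr
        exact (norm_sum_le _ _).trans_eq (by simp)
    _ ≤ (∑ k ∈ s, ‖f k t‖ ^ 2) * ∑ k ∈ s, ‖h k t‖ ^ 2 := Finset.sum_mul_sq_le_sq_mul_sq _ _ _
    _ ≤ C * ∑ k ∈ s, ‖h k t‖ ^ 2 := by gcongr

namespace HinfSubalg

variable (A : HinfSubalg)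

theorem lpMul_mem_Hg (g : H2) {f : LSp ⊤} (hf : f ∈ A.carrier) {h : LSp 2} (hh : h ∈ A.Hg g) :
    lpMul 2 f h ∈ A.Hg g := by
  rw [← SetLike.mem_coe, Hg, cyclic, Submodule.topologicalClosure_coe] at hh ⊢
  refine map_mem_closure (lpMul 2 f).continuous hh fun u hu => ?_
  rw [SetLike.mem_coe] at hu ⊢
  induction hu using Submodule.span_induction with
  | mem u hu =>
    obtain ⟨f', hf', rfl⟩ := hu
    rw [lpMul_assoc]
    exact Submodule.subset_span ⟨_, A.unital_subalg.2 f hf f' hf', rfl⟩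
  | zero => rw [map_zero]; exact Submodule.zero_mem _
  | add u v _ _ hu hv => rw [map_add]; exact Submodule.add_mem _ hu hv
  | smul c u _ hu => rw [map_smul]; exact Submodule.smul_mem _ c hu

/-- Multiplication by `f ∈ A` on `H_g`. -/
def mulHg (g : H2) (f : LSp ⊤) (hf : f ∈ A.carrier) : A.Hg g →L[ℂ] A.Hg g :=
  ((lpMul 2 f).comp (A.Hg g).subtypeL).codRestrict (A.Hg g) fun h => A.lpMul_mem_Hg g hf h.2

/-- The Hilbert space `H_g ⊗ ℓ²`, realized as the `ℓ²`-direct sum of copies of `H_g`. -/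
abbrev HgTensor (g : H2) : Type := lp (fun _ : ℕ => A.Hg g) 2

variable {A}

theorem BddSeq.exists_bound (F : A.BddSeq) : ∃ C : ℝ, 0 ≤ C ∧ ∀ z : Disk, ∀ s : Finset ℕ,
    ∑ k ∈ s, ‖diskEval (F.comp k) z‖ ^ 2 ≤ C ^ 2 := by
  obtain ⟨C, hC⟩ := F.bdd
  refine ⟨max C 0, le_max_right _ _, fun z s => ?_⟩
  have h1 : ‖F.val z‖ ≤ max C 0 := (hC ⟨z, rfl⟩).trans (le_max_left _ _)
  have h2 := lp.sum_rpow_le_norm_rpow (p := 2) (by norm_num) (F.val z) s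
  have h3 : ∑ k ∈ s, ‖diskEval (F.comp k) z‖ ^ 2 ≤ ‖F.val z‖ ^ 2 := by
    simpa [HinfSubalg.BddSeq.val] using h2
  exact h3.trans (by gcongr)

theorem BddSeq.norm_partial_le (F : A.BddSeq) (g : H2) {C : ℝ}
    (hC : ∀ z : Disk, ∀ s : Finset ℕ, ∑ k ∈ s, ‖diskEval (F.comp k) z‖ ^ 2 ≤ C ^ 2)
    (h : ℕ → A.Hg g) (s : Finset ℕ) :
    ‖∑ k ∈ s, A.mulHg g (F.comp k) (F.mem k) (h k)‖ ^ 2 ≤ C ^ 2 * ∑ k ∈ s, ‖h k‖ ^ 2 := by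
  have := norm_row_le s F.comp (fun k => A.le_hardy (F.mem k)) (C ^ 2) (fun z => hC z s)
    (fun k => (h k : LSp 2))
  refine le_trans (le_of_eq ?_) this
  rw [← Submodule.norm_coe]
  congr 2
  simp only [Submodule.coe_sum]
  rfl

theorem BddSeq.summable_row (F : A.BddSeq) (g : H2) (h : A.HgTensor g) :
    Summable fun k => A.mulHg g (F.comp k) (F.mem k) (h k) := by
  obtain ⟨C, hC0, hC⟩ := F.exists_bound
  have hs : Summable fun k => ‖h k‖ ^ 2 := by
    simpa using (lp.memℓp h).summable (by norm_num)
  rw [summable_iff_vanishing_norm] at hs ⊢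
  intro ε hε
  obtain ⟨s, hs⟩ := hs ((ε / (C + 1)) ^ 2) (by positivity)
  refine ⟨s, fun t ht => ?_⟩
  have h1 := F.norm_partial_le g hC (fun k => h k) t
  have h2 := (le_abs_self _).trans_lt (hs t ht)
  refine lt_of_pow_lt_pow_left₀ 2 hε.le ?_
  calc _ ≤ C ^ 2 * ∑ k ∈ t, ‖h k‖ ^ 2 := h1
    _ ≤ (C + 1) ^ 2 * ∑ k ∈ t, ‖h k‖ ^ 2 := by gcongr; linarith
    _ < (C + 1) ^ 2 * (ε / (C + 1)) ^ 2 := by gcongr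
    _ = ε ^ 2 := by field_simp

/-- The operator `M_{F,g} : H_g ⊗ ℓ² → H_g`, `(h_k) ↦ ∑ f_k h_k`, of a row `F = (f_k)`. -/
def rowOp (F : A.Row) (g : H2) : A.HgTensor g →L[ℂ] A.Hg g :=
  LinearMap.mkContinuousOfExistsBound
    { toFun := fun h => ∑' k, A.mulHg g (F.comp k) (F.mem k) (h k)
      map_add' := fun h h' => by
        rw [← (F.summable_row g h).tsum_add (F.summable_row g h')]
        simp
      map_smul' := fun c h => by
        rw [RingHom.id_apply, ← (F.summable_row g h).tsum_const_smul]
        simp }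
    (by
      obtain ⟨C, hC0, hC⟩ := F.exists_bound
      refine ⟨C, fun h => ?_⟩
      refine le_of_tendsto (F.summable_row g h).hasSum.norm
        (Filter.Eventually.of_forall fun s => ?_)
      have h1 := F.norm_partial_le g hC (fun k => h k) s
      have h2 : ∑ k ∈ s, ‖h k‖ ^ 2 ≤ ‖h‖ ^ 2 := by
        simpa using lp.sum_rpow_le_norm_rpow (p := 2) (by norm_num) h s
      refine le_of_sq_le_sq ?_ (by positivity)
      calc _ ≤ C ^ 2 * ∑ k ∈ s, ‖h k‖ ^ 2 := h1
        _ ≤ C ^ 2 * ‖h‖ ^ 2 := by gcongr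
        _ = (C * ‖h‖) ^ 2 := by ring)

end HinfSubalg

/-- `α² ⟨v_j, v_i⟩ - w_i w̄_j` times `K_g(x_i, x_j)`; `inner ℂ u v` is linear in `v`. -/
def HinfSubalg.Q (A : HinfSubalg) {n : ℕ} (α : ℝ) (x : Fin n → Disk) (v : Fin n → ell2)
    (w : Fin n → ℂ) (g : H2) : Matrix (Fin n) (Fin n) ℂ :=
  Matrix.of fun i j =>
    ((α : ℂ) ^ 2 * inner ℂ (v i) (v j) - w i * conj (w j)) * A.kernel g (x i) (x j)

end

noncomputable section

/-! ### Evaluation at points of the disk -/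

/-! The sufficiency half of part 1 and all of part 2 rest on one duality argument. By L¹–L^∞ duality
and weak-star closedness of A, a column over A of norm at most α arises from any functional of norm
at most α on L¹(ℓ²) that kills the preannihilator N of the columns (`exists_col_of_dual`); its value
at z is read off by testing on the Poisson kernel at z. By Hahn–Banach, prescribed values w_i of Σ_k
u_i(k) f_k(x_i) can therefore be attained as soon as |Σ c_i w_i| ≤ α ‖Ψ‖ for every Ψ = Σ c_i P_{x_i}
u_i + n with n in N.

To prove this bound, Ψ is factored (`exists_admissible_factorization`). Elements of A are measurable
for the σ-algebra of A, so Ψ may be replaced by its conditional expectation Φ without changing its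
pairings with A. An outer g of norm one with |g|² proportional to ‖Φ‖ + ε is admissible, and Ψ_k
acts on A as fg ↦ ⟨fg, η_k⟩ with Σ ‖η_k‖² ≤ (‖Ψ‖ + ε)². On H_g this functional is a combination of
evaluations, hence is represented by a combination of kernel functions, which is the projection of
η_k and has no larger norm. A norm inequality between combinations of kernel functions of H_g then
gives the bound as ε → 0 (`exists_col_of_ker_bound`).

Both criteria are such inequalities. Positivity of Q_g says ‖Σ c_i w̄_i k_{x_i}‖² ≤ α² Σ_k ‖Σ c_i
v_i(k) k_{x_i}‖², where k_x is the kernel function at x. The adjoint of the row operator sends k_z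
to the sequence with entries conj(f_k(z)) k_z, so M M* ≥ δ² is the same kind of inequality with α =
1/δ, target values 1, and all points of the disk as nodes. The necessity half of part 1 is direct:
multiplication by a column of norm at most α is bounded by α on H_g. -/

theorem fourierCoeff_lpMul_fourierLp (f : LSp ⊤) (k n : ℤ) :
    fourierCoeff (lpMul 2 f (fourierLp 2 k) : Circ → ℂ) n = fourierCoeff (f : Circ → ℂ) (n - k) := by
  refine integral_congr_ae ?_
  filter_upwards [lpMul_coe 2 f (fourierLp 2 k), coeFn_fourierLp (T := 1) 2 k] with t h1 h2
  rw [h1, h2, neg_sub, sub_eq_add_neg, fourier_add, smul_eq_mul, smul_eq_mul]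
  ring

theorem fourierCoeff_fourierLp (p : ℝ≥0∞) [Fact (1 ≤ p)] (k n : ℤ) :
    fourierCoeff ((fourierLp p k : LSp p) : Circ → ℂ) n = if n = k then 1 else 0 := by
  rw [fourierCoeff_congr_ae (coeFn_fourierLp (T := 1) p k), fourierCoeff_fourier, Pi.single_apply]

theorem fourierLp_mem_hardy (p : ℝ≥0∞) [Fact (1 ≤ p)] (k : ℕ) :
    (fourierLp p k : LSp p) ∈ hardy p := fun n hn => by
  rw [fourierCoeff_fourierLp, if_neg (by omega)]

theorem evalCLM_apply (z : Disk) (f : LSp 2) : evalCLM z f = diskEval f z := rfl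

theorem evalCLM_fourierLp (z : Disk) (k : ℕ) : evalCLM z (fourierLp 2 k) = (z : ℂ) ^ k := by
  rw [evalCLM_apply, diskEval, tsum_eq_single k]
  · rw [fourierCoeff_fourierLp, if_pos rfl, one_mul]
  · intro n hn
    rw [fourierCoeff_fourierLp, if_neg (by exact_mod_cast hn), zero_mul]

/-- Multiplication by the k-th monomial shifts coefficients by k. The coefficients that enter from
negative indices vanish because f is in H^∞. -/
theorem evalCLM_lpMul_fourierLp {f : LSp ⊤} (hf : f ∈ hardy ⊤) (z : Disk) (k : ℕ) :
    evalCLM z (lpMul 2 f (fourierLp 2 k)) = diskEval f z * (z : ℂ) ^ k := by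
  rw [evalCLM_apply, diskEval, diskEval, ← tsum_mul_right]
  simp only [fourierCoeff_lpMul_fourierLp]
  have hinj : Function.Injective fun n : ℕ => n + k := add_left_injective k
  rw [← hinj.tsum_eq]
  · refine tsum_congr fun n => ?_
    push_cast
    rw [add_sub_cancel_right, pow_add, mul_assoc]
  · intro n hn
    by_contra hcon
    have hlt : n < k := by
      by_contra h
      exact hcon ⟨n - k, by simp; omega⟩
    exact hn (by simp only; rw [hf _ (by omega), zero_mul])

/-- Evaluation is multiplicative. -/
theorem evalCLM_lpMul {f : LSp ⊤} (hf : f ∈ hardy ⊤) {h : LSp 2} (hh : h ∈ hardy 2) (z : Disk) :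
    evalCLM z (lpMul 2 f h) = diskEval f z * evalCLM z h := by
  have h1 := (hasSum_fourier_series_L2 (T := 1) h).mapL ((evalCLM z).comp (lpMul 2 f))
  have h2 := ((hasSum_fourier_series_L2 (T := 1) h).mapL (evalCLM z)).mul_left (diskEval f z)
  -- Both sides are continuous in h, so they are compared term by term on the Fourier series of h.
  refine h1.unique (h2.congr_fun ?_)
  intro k
  rw [map_smul, map_smul]
  rcases lt_or_ge k 0 with hk | hk
  · rw [hh k hk, zero_smul, zero_smul, mul_zero]
  · obtain ⟨m, rfl⟩ := Int.eq_ofNat_of_zero_le hk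
    rw [ContinuousLinearMap.comp_apply, evalCLM_lpMul_fourierLp hf, evalCLM_fourierLp, smul_eq_mul,
      smul_eq_mul]
    ring

theorem oneInf_coe : (oneInf : Circ → ℂ) =ᵐ[arc] fun _ => 1 := MemLp.coeFn_toLp _

theorem oneInf_eq_fourierLp : oneInf = fourierLp ⊤ 0 := by
  apply Lp.ext
  filter_upwards [oneInf_coe, coeFn_fourierLp (T := 1) ⊤ 0] with t h1 h2
  rw [h1, h2, fourier_zero]

theorem lpMul_oneInf (p : ℝ≥0∞) [Fact (1 ≤ p)] (h : LSp p) : lpMul p oneInf h = h := by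
  apply Lp.ext
  filter_upwards [lpMul_coe p oneInf h, oneInf_coe] with t h1 h2
  rw [h1, h2, one_mul]

theorem lpMul_comm (f g : LSp ⊤) : lpMul ⊤ f g = lpMul ⊤ g f := by
  apply Lp.ext
  filter_upwards [lpMul_coe ⊤ f g, lpMul_coe ⊤ g f] with t h1 h2
  rw [h1, h2, mul_comm]

/-! ### The Szegő kernel and the Poisson kernel -/

/-- The vector that represents evaluation at `z`. -/
def szego (z : Disk) : LSp 2 := (InnerProductSpace.toDual ℂ (LSp 2)).symm (evalCLM z)

theorem inner_szego (z : Disk) (h : LSp 2) : inner ℂ (szego z) h = evalCLM z h :=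
  InnerProductSpace.toDual_symm_apply

theorem szego_mem_hardy (z : Disk) : szego z ∈ hardy 2 := fun n hn => by
  rw [fourierCoeff_eq_inner, ← inner_conj_symm, inner_szego, evalCLM_apply, diskEval]
  have : ∀ m : ℕ, fourierCoeff ((fourierLp 2 n : LSp 2) : Circ → ℂ) m * (z : ℂ) ^ m = 0 :=
    fun m => by rw [fourierCoeff_fourierLp, if_neg (by omega), zero_mul]
  rw [tsum_congr this, tsum_zero, map_zero]

theorem szego_ne_zero (z : Disk) : szego z ≠ 0 := fun h => by
  have h1 := inner_szego z (fourierLp 2 ((0 : ℕ) : ℤ))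
  rw [h, inner_zero_left, evalCLM_fourierLp, pow_zero] at h1
  exact zero_ne_one h1

theorem integrable_norm_sq (u : LSp 2) : Integrable (fun t => ‖u t‖ ^ 2) arc :=
  (Lp.memLp u).integrable_norm_pow (by norm_num)

theorem memLp_poisson (z : Disk) :
    MemLp (fun t => ((‖szego z t‖ ^ 2 / ‖szego z‖ ^ 2 : ℝ) : ℂ)) 1 arc := by
  rw [memLp_one_iff_integrable]
  exact ((integrable_norm_sq (szego z)).div_const _).ofReal

/-- The Poisson kernel at `z`. -/
def poisson (z : Disk) : LSp 1 := (memLp_poisson z).toLp _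

theorem poisson_coe (z : Disk) : (poisson z : Circ → ℂ) =ᵐ[arc]
    fun t => ((‖szego z t‖ ^ 2 / ‖szego z‖ ^ 2 : ℝ) : ℂ) := (memLp_poisson z).coeFn_toLp

/-- Norm exactly one is what makes the sup norm of a column on the disk at most the norm of the
functional on L¹(ℓ²) that produces it. -/
theorem norm_poisson (z : Disk) : ‖poisson z‖ = 1 := by
  rw [L1.norm_eq_integral_norm]
  have h1 : ∫ t, ‖poisson z t‖ ∂arc = ∫ t, ‖szego z t‖ ^ 2 / ‖szego z‖ ^ 2 ∂arc := by
    refine integral_congr_ae ?_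
    filter_upwards [poisson_coe z] with t ht
    rw [ht, Complex.norm_real, Real.norm_of_nonneg (by positivity)]
  rw [h1, integral_div, ← norm_sq_eq_integral, div_self]
  have := norm_pos_iff.2 (szego_ne_zero z)
  positivity

/-- With k = `szego z`, the inner product of fk with k is the value of fk at z, namely f(z) k(z),
and k(z) = ‖k‖². Dividing by ‖k‖² gives the formula. -/
theorem integral_mul_poisson {f : LSp ⊤} (hf : f ∈ hardy ⊤) (z : Disk) :
    ∫ t, f t * poisson z t ∂arc = diskEval f z := by
  have hn : (‖szego z‖ ^ 2 : ℂ) ≠ 0 := by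
    have := norm_ne_zero_iff.2 (szego_ne_zero z)
    exact_mod_cast pow_ne_zero 2 this
  have h1 := inner_szego z (lpMul 2 f (szego z))
  rw [evalCLM_lpMul hf (szego_mem_hardy z), ← inner_szego z (szego z),
    inner_self_eq_norm_sq_to_K, L2.inner_def] at h1
  have h2 : ∫ t, f t * poisson z t ∂arc =
      (∫ t, inner ℂ (szego z t) (lpMul 2 f (szego z) t) ∂arc) / (‖szego z‖ ^ 2 : ℂ) := by
    rw [← integral_div]
    refine integral_congr_ae ?_
    filter_upwards [poisson_coe z, lpMul_coe 2 f (szego z)] with t ht h2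
    rw [ht, h2, RCLike.inner_apply]
    push_cast
    rw [← Complex.mul_conj']
    ring
  rw [h2, h1]
  exact mul_div_cancel_right₀ _ hn

/-! ### Outer functions with prescribed modulus -/

/-- A nonnegative integrable function on the circle all of whose Fourier coefficients of nonzero
index vanish is constant. -/
theorem ae_eq_const_of_integral_fourier_mul {φ : Circ → ℝ} (hm : Measurable φ) (h0 : ∀ t, 0 ≤ φ t)
    (hφ : Integrable φ arc) (h : ∀ n : ℤ, n ≠ 0 → ∫ t, fourier n t * (φ t : ℂ) ∂arc = 0) :
    ∀ᵐ t ∂arc, φ t = ∫ s, φ s ∂arc := by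
  set κ : ℝ := ∫ s, φ s ∂arc with hκ
  have hκ0 : 0 ≤ κ := integral_nonneg h0
  have hdense : Dense (Submodule.span ℂ (Set.range (fourier (T := 1))) : Set C(Circ, ℂ)) := by
    rw [Submodule.dense_iff_topologicalClosure_eq_top]
    exact span_fourier_closure_eq_top
  have hint : ∀ F : C(Circ, ℂ), Integrable (fun t => F t * ((φ t - κ : ℝ) : ℂ)) arc := fun F => by
    have h1 : Integrable (fun t => ((φ t - κ : ℝ) : ℂ)) arc :=
      (hφ.sub (integrable_const κ)).ofReal
    refine h1.bdd_mul (c := ‖F‖) F.continuous.aestronglyMeasurable ?_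
    exact Filter.Eventually.of_forall F.norm_coe_le_norm
  -- Integration against φ − κ is bounded on continuous functions and vanishes on every character:
  -- for n ≠ 0 by hypothesis, for n = 0 by the choice of κ. Density of trigonometric polynomials
  -- makes it zero.
  let L : C(Circ, ℂ) →L[ℂ] ℂ := LinearMap.mkContinuous
    { toFun := fun F => ∫ t, F t * ((φ t - κ : ℝ) : ℂ) ∂arc
      map_add' := fun F G => by
        rw [← integral_add (hint F) (hint G)]
        simp only [ContinuousMap.add_apply, add_mul]
      map_smul' := fun c F => by
        rw [RingHom.id_apply, smul_eq_mul, ← integral_const_mul]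
        simp only [ContinuousMap.smul_apply, smul_eq_mul, mul_assoc] }
    (∫ t, ‖((φ t - κ : ℝ) : ℂ)‖ ∂arc) (fun F => by
      rw [mul_comm, ← integral_const_mul]
      refine norm_integral_le_of_norm_le ?_ (Filter.Eventually.of_forall fun t => ?_)
      · exact ((hφ.sub (integrable_const κ)).ofReal (𝕜 := ℂ)).norm.const_mul _
      · rw [norm_mul]
        gcongr
        exact F.norm_coe_le_norm t)
  have hL : L = 0 := by
    refine ContinuousLinearMap.ext_on hdense ?_
    rintro _ ⟨n, rfl⟩
    change ∫ t, fourier n t * ((φ t - κ : ℝ) : ℂ) ∂arc = 0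
    have hi : Integrable (fun t => fourier n t * (φ t : ℂ)) arc := by
      refine hφ.ofReal.bdd_mul (c := 1) (fourier n).continuous.aestronglyMeasurable ?_
      exact Filter.Eventually.of_forall fun t => by rw [fourier_apply, Circle.norm_coe]
    have hj : Integrable (fun t : Circ => fourier n t * (κ : ℂ)) arc :=
      ((fourier n).continuous.integrable_of_hasCompactSupport
        (HasCompactSupport.of_compactSpace _)).mul_const _
    have e : ∀ t, fourier n t * ((φ t - κ : ℝ) : ℂ) =
        fourier n t * (φ t : ℂ) - fourier n t * (κ : ℂ) := fun t => by push_cast; ring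
    simp only [e]
    rw [integral_sub hi hj, integral_mul_const]
    rcases eq_or_ne n 0 with rfl | hn
    · simp only [fourier_zero, one_mul]
      rw [integral_complex_ofReal]
      simp [hκ]
    · have h2 := congrFun (fourierCoeff_fourier (T := 1) n) 0
      rw [Pi.single_apply, if_neg hn.symm, fourierCoeff] at h2
      simp only [neg_zero, fourier_zero, one_smul] at h2
      rw [h n hn, h2, zero_mul, sub_zero]
  have hreal : ∀ f : BoundedContinuousFunction Circ ℝ,
      ∫ t, φ t * f t ∂arc = ∫ t, κ * f t ∂arc := fun f => by
    have h1 : L ⟨fun t => (f t : ℂ), by fun_prop⟩ = 0 := by rw [hL]; rfl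
    have h2 : ∫ t, ((f t * (φ t - κ) : ℝ) : ℂ) ∂arc = 0 := by
      simpa [L] using h1
    rw [integral_complex_ofReal, Complex.ofReal_eq_zero] at h2
    have i1 : Integrable (fun t => φ t * f t) arc :=
      hφ.mul_bdd (c := ‖f‖) f.continuous.aestronglyMeasurable
        (Filter.Eventually.of_forall f.norm_coe_le_norm)
    have i2 : Integrable (fun t => κ * f t) arc := (f.integrable arc).const_mul _
    rw [← sub_eq_zero, ← integral_sub i1 i2, ← h2]
    exact integral_congr_ae (Filter.Eventually.of_forall fun t => by ring)
  have hφl : ∫⁻ t, ENNReal.ofReal (φ t) ∂arc ≠ ∞ := hφ.lintegral_lt_top.ne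
  have hm' : Measurable fun t => ENNReal.ofReal (φ t) := hm.ennreal_ofReal
  have := isFiniteMeasure_withDensity hφl
  have : IsFiniteMeasure (arc.withDensity fun _ : Circ => ENNReal.ofReal κ) :=
    isFiniteMeasure_withDensity (by simp)
  -- Finite measures that agree on continuous functions coincide, and then so do their densities
  -- almost everywhere.
  have hμ : (arc.withDensity fun t => ENNReal.ofReal (φ t)) =
      arc.withDensity fun _ => ENNReal.ofReal κ := by
    refine ext_of_forall_integral_eq_of_IsFiniteMeasure fun f => ?_
    rw [integral_withDensity_eq_integral_toReal_smul hm' (by simp),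
      integral_withDensity_eq_integral_toReal_smul measurable_const (by simp)]
    simpa [ENNReal.toReal_ofReal hκ0, ENNReal.toReal_ofReal (h0 _)] using hreal f
  filter_upwards [(withDensity_eq_iff hm'.aemeasurable aemeasurable_const hφl).1 hμ] with t ht
  exact (ENNReal.ofReal_eq_ofReal_iff (h0 t) hκ0).1 ht

/-- Used throughout to pass from generators fg to the whole cyclic space. With `W := ⊥` it shows
that a functional vanishing on the generators vanishes on their closed span. -/
theorem map_mem_of_mem_topologicalClosure_span {E F : Type*} [NormedAddCommGroup E]
    [NormedSpace ℂ E] [NormedAddCommGroup F] [NormedSpace ℂ F] (T : E →L[ℂ] F) {s : Set E}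
    {W : Submodule ℂ F} (hW : IsClosed (W : Set F)) (h : ∀ x ∈ s, T x ∈ W) {x : E}
    (hx : x ∈ (Submodule.span ℂ s).topologicalClosure) : T x ∈ W := by
  have : (Submodule.span ℂ s).topologicalClosure ≤ W.comap (T : E →ₗ[ℂ] F) :=
    Submodule.topologicalClosure_minimal _ (Submodule.span_le.2 h) (hW.preimage T.continuous)
  exact this hx

theorem isClosed_cyclic (S : Set (LSp ⊤)) (g : LSp 2) : IsClosed (cyclic S g : Set (LSp 2)) :=
  Submodule.isClosed_topologicalClosure _

theorem lpMul_mem_cyclic {S : Set (LSp ⊤)} {f : LSp ⊤} (hf : f ∈ S) (g : LSp 2) :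
    lpMul 2 f g ∈ cyclic S g :=
  Submodule.le_topologicalClosure _ (Submodule.subset_span ⟨f, hf, rfl⟩)

theorem hardy_two_le_of_fourierLp_mem {W : Submodule ℂ (LSp 2)} (hW : IsClosed (W : Set (LSp 2)))
    (h : ∀ k : ℕ, (fourierLp 2 k : LSp 2) ∈ W) : hardy 2 ≤ W := by
  intro u hu
  refine hW.mem_of_tendsto (hasSum_fourier_series_L2 (T := 1) u)
    (Filter.Eventually.of_forall fun s => Submodule.sum_mem _ fun k _ => ?_)
  rcases lt_or_ge k 0 with hk | hk
  · rw [hu k hk, zero_smul]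
    exact Submodule.zero_mem _
  · obtain ⟨m, rfl⟩ := Int.eq_ofNat_of_zero_le hk
    exact Submodule.smul_mem _ _ (h m)

/-- If g vanished at z, so would every element of the closure of H^∞ g; but that closure contains 1.
-/
theorem IsOuter.evalCLM_ne_zero {g : H2} (hg : IsOuter g) (z : Disk) :
    evalCLM z (g : LSp 2) ≠ 0 := fun h0 => by
  have h1 : (fourierLp 2 ((0 : ℕ) : ℤ) : LSp 2) ∈ cyclic (hardy ⊤ : Set (LSp ⊤)) g := by
    rw [show cyclic (hardy ⊤ : Set (LSp ⊤)) g = hardy 2 from hg]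
    exact fourierLp_mem_hardy 2 0
  have h2 := map_mem_of_mem_topologicalClosure_span (evalCLM z) (W := ⊥) isClosed_singleton
    (by
      rintro _ ⟨f, hf, rfl⟩
      rw [Submodule.mem_bot, evalCLM_lpMul hf g.2, h0, mul_zero]) h1
  rw [Submodule.mem_bot, evalCLM_fourierLp, pow_zero] at h2
  exact one_ne_zero h2

theorem inner_lpMul_fourierLp (u v : LSp 2) (n : ℤ) :
    inner ℂ u (lpMul 2 (fourierLp ⊤ n) v) = ∫ t, fourier n t * v t * conj (u t) ∂arc := by
  rw [L2.inner_def]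
  refine integral_congr_ae ?_
  filter_upwards [lpMul_coe 2 (fourierLp ⊤ n) v, coeFn_fourierLp (T := 1) ⊤ n] with t h1 h2
  rw [h1, h2, RCLike.inner_apply]

/-- If `h` is orthogonal to `zⁿ h` for `n ≥ 1`, then `|h|` is constant. -/
theorem norm_ae_eq_of_inner_fourierLp {h : LSp 2}
    (horth : ∀ n : ℕ, inner ℂ h (lpMul 2 (fourierLp ⊤ ((n + 1 : ℕ) : ℤ)) h) = 0) :
    ∀ᵐ t ∂arc, ‖h t‖ = ‖h‖ := by
  have hpos : ∀ n : ℕ, ∫ t, fourier ((n + 1 : ℕ) : ℤ) t * ((‖h t‖ ^ 2 : ℝ) : ℂ) ∂arc = 0 :=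
    fun n => by
      rw [← horth n, inner_lpMul_fourierLp]
      refine integral_congr_ae (Filter.Eventually.of_forall fun t => ?_)
      simp only [mul_assoc]
      rw [Complex.mul_conj']
      push_cast
      rfl
  have key := ae_eq_const_of_integral_fourier_mul (φ := fun t => ‖h t‖ ^ 2)
    ((Lp.stronglyMeasurable h).norm.pow 2).measurable (fun t => by positivity)
    (integrable_norm_sq h) (fun n hn => by
      rcases lt_or_gt_of_ne hn with hlt | hgt
      -- Since |h|² is real, its coefficients of opposite index are conjugate, so one sign of the
      -- index suffices.
      · have e := congrArg conj (hpos ((-n).toNat - 1))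
        rw [← integral_conj, map_zero] at e
        rw [← e]
        refine integral_congr_ae (Filter.Eventually.of_forall fun t => ?_)
        have e2 : n = -(((-n).toNat - 1 + 1 : ℕ) : ℤ) := by omega
        simp only [map_mul, Complex.conj_ofReal]
        rw [← fourier_neg, ← e2]
      · have e2 : n = ((n.toNat - 1 + 1 : ℕ) : ℤ) := by omega
        rw [e2]
        exact hpos _)
  filter_upwards [key] with t ht
  rw [← norm_sq_eq_integral] at ht
  exact (pow_left_inj₀ (norm_nonneg _) (norm_nonneg _) two_ne_zero).1 ht

theorem lpMul_fourierLp_fourierLp (p : ℝ≥0∞) [Fact (1 ≤ p)] (m n : ℤ) :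
    lpMul p (fourierLp ⊤ m) (fourierLp p n) = fourierLp p (m + n) := by
  apply Lp.ext
  filter_upwards [lpMul_coe p (fourierLp ⊤ m) (fourierLp p n), coeFn_fourierLp (T := 1) ⊤ m,
    coeFn_fourierLp (T := 1) p n, coeFn_fourierLp (T := 1) p (m + n)] with t h1 h2 h3 h4
  rw [h1, h2, h3, h4, fourier_add]

/-- A function in `L²` that is bounded below by a positive constant is the modulus of an outer
function. -/
theorem exists_isOuter_norm_eq {ρ : Circ → ℝ} (hρ : MemLp ρ 2 arc) {c : ℝ} (hc : 0 < c)
    (hcρ : ∀ t, c ≤ ρ t) : ∃ g : H2, IsOuter g ∧ ∀ᵐ t ∂arc, ‖(g : LSp 2) t‖ = ρ t := by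
  have hρ0 : ∀ t, 0 < ρ t := fun t => hc.trans_le (hcρ t)
  have hRm : MemLp (fun t => (ρ t : ℂ)) 2 arc := hρ.ofReal
  set R : LSp 2 := hRm.toLp _ with hR
  have hRc : (R : Circ → ℂ) =ᵐ[arc] fun t => (ρ t : ℂ) := hRm.coeFn_toLp
  -- Beurling's construction: h is the part of R orthogonal to S, the closed span of the zⁿR with n
  -- ≥ 1, and lies in the closed span of the zⁿR with n ≥ 0. Hence zⁿh is in S for n ≥ 1, h is
  -- orthogonal to it, and |h| is constant. The outer function will be conj(h) R / ‖h‖.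
  set s : Set (LSp 2) := Set.range fun n : ℕ => lpMul 2 (fourierLp ⊤ ((n + 1 : ℕ) : ℤ)) R with hs
  set s₀ : Set (LSp 2) := Set.range fun n : ℕ => lpMul 2 (fourierLp ⊤ (n : ℤ)) R with hs₀
  set S := (Submodule.span ℂ s).topologicalClosure with hSdef
  have hSc : IsClosed (S : Set (LSp 2)) := Submodule.isClosed_topologicalClosure _
  have : CompleteSpace S := hSc.completeSpace_coe
  set q := S.starProjection R with hq
  have hqS : q ∈ S := Submodule.starProjection_apply_mem _ _
  set h := R - q with hh
  have horth : ∀ u ∈ S, inner ℂ h u = 0 := fun u hu => by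
    rw [← inner_conj_symm, (Submodule.mem_orthogonal _ _).1
      (Submodule.sub_starProjection_mem_orthogonal (K := S) R) u hu, map_zero]
  have hS₀ : h ∈ (Submodule.span ℂ s₀).topologicalClosure := by
    refine Submodule.sub_mem _ (Submodule.le_topologicalClosure _ (Submodule.subset_span ⟨0, ?_⟩))
      (Submodule.topologicalClosure_mono (Submodule.span_mono ?_) hqS)
    · simp only [Nat.cast_zero, ← oneInf_eq_fourierLp, lpMul_oneInf]
    · rintro _ ⟨n, rfl⟩
      exact ⟨n + 1, rfl⟩
  have hshift : ∀ n : ℕ, lpMul 2 (fourierLp ⊤ ((n + 1 : ℕ) : ℤ)) h ∈ S := fun n => by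
    refine map_mem_of_mem_topologicalClosure_span (lpMul 2 (fourierLp ⊤ ((n + 1 : ℕ) : ℤ))) hSc ?_
      hS₀
    rintro _ ⟨m, rfl⟩
    refine Submodule.le_topologicalClosure _ (Submodule.subset_span ⟨n + m, ?_⟩)
    simp only
    rw [lpMul_assoc, lpMul_fourierLp_fourierLp]
    congr 3
    push_cast
    ring
  have hconst := norm_ae_eq_of_inner_fourierLp fun n => horth _ (hshift n)
  -- If h = 0 then R is in S; multiplying by the bounded function 1/ρ puts 1 in the closed span of
  -- the zⁿ with n ≥ 1, yet 1 is orthogonal to all of them. This is where the lower bound c is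
  -- needed.
  have hne : h ≠ 0 := fun h0 => by
    have hRS : R ∈ S := by
      rw [← sub_eq_zero.1 h0] at hqS
      exact hqS
    have hDm : MemLp (fun t => ((ρ t)⁻¹ : ℂ)) ⊤ arc := by
      refine memLp_top_of_bound (C := c⁻¹)
        (hRm.aestronglyMeasurable.aemeasurable.inv.aestronglyMeasurable)
        (Filter.Eventually.of_forall fun t => ?_)
      rw [norm_inv, Complex.norm_real, Real.norm_of_nonneg (hρ0 t).le]
      exact inv_anti₀ hc (hcρ t)
    set D : LSp ⊤ := hDm.toLp _
    have hD : ∀ n : ℤ, lpMul 2 D (lpMul 2 (fourierLp ⊤ n) R) = fourierLp 2 n := fun n => by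
      apply Lp.ext
      filter_upwards [lpMul_coe 2 D (lpMul 2 (fourierLp ⊤ n) R), hDm.coeFn_toLp,
        lpMul_coe 2 (fourierLp ⊤ n) R, coeFn_fourierLp (T := 1) ⊤ n, hRc,
        coeFn_fourierLp (T := 1) 2 n] with t h1 h2 h3 h4 h5 h6
      rw [h1, h2, h3, h4, h5, h6]
      have : (ρ t : ℂ) ≠ 0 := by exact_mod_cast (hρ0 t).ne'
      field_simp
    have h1 := map_mem_of_mem_topologicalClosure_span
      ((innerSL ℂ (fourierLp 2 0 : LSp 2)).comp (lpMul 2 D)) (W := ⊥) isClosed_singleton (by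
        rintro _ ⟨n, rfl⟩
        rw [Submodule.mem_bot, ContinuousLinearMap.comp_apply, hD, innerSL_apply_apply,
          ← fourierCoeff_eq_inner, fourierCoeff_fourierLp, if_neg (by omega)]) hRS
    have hD0 := hD 0
    rw [← oneInf_eq_fourierLp, lpMul_oneInf] at hD0
    rw [Submodule.mem_bot, ContinuousLinearMap.comp_apply, hD0, innerSL_apply_apply,
      ← fourierCoeff_eq_inner, fourierCoeff_fourierLp, if_pos rfl] at h1
    exact one_ne_zero h1
  have hn0 : (‖h‖ : ℂ) ≠ 0 := by exact_mod_cast norm_ne_zero_iff.2 hne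
  have hVm : MemLp (fun t => conj (h t) / (‖h‖ : ℂ)) ⊤ arc := by
    refine memLp_top_of_bound (C := 1) ?_ ?_
    · exact ((Complex.continuous_conj.comp_aestronglyMeasurable
        (Lp.aestronglyMeasurable h)).mul_const _)
    · filter_upwards [hconst] with t ht
      rw [norm_div, Complex.norm_conj, ht, Complex.norm_real, norm_norm]
      exact div_self_le_one _
  set V : LSp ⊤ := hVm.toLp _
  have hVc : (V : Circ → ℂ) =ᵐ[arc] fun t => conj (h t) / (‖h‖ : ℂ) := hVm.coeFn_toLp
  set G : LSp 2 := lpMul 2 V R with hG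
  have hGc : (G : Circ → ℂ) =ᵐ[arc] fun t => conj (h t) / (‖h‖ : ℂ) * (ρ t : ℂ) := by
    filter_upwards [lpMul_coe 2 V R, hVc, hRc] with t h1 h2 h3
    rw [h1, h2, h3]
  -- The coefficient of G at −m is ⟨z^m R, h⟩ / ‖h‖, which vanishes for m ≥ 1 because h is
  -- orthogonal to S.
  have hGmem : G ∈ hardy 2 := fun n hn => by
    have h1 := horth _ (Submodule.le_topologicalClosure _ (Submodule.subset_span
      (s := s) ⟨(-n).toNat - 1, rfl⟩))
    simp only at h1
    rw [show (((-n).toNat - 1 + 1 : ℕ) : ℤ) = -n by omega, inner_lpMul_fourierLp] at h1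
    rw [fourierCoeff, ← zero_div (‖h‖ : ℂ), ← h1, ← integral_div]
    refine integral_congr_ae ?_
    filter_upwards [hGc, hRc] with t h2 h3
    rw [h2, h3, smul_eq_mul]
    ring
  refine ⟨⟨G, hGmem⟩, ?_, ?_⟩
  · refine le_antisymm (cyclic_le_hardy (Set.Subset.refl _) hGmem)
      (hardy_two_le_of_fourierLp_mem (isClosed_cyclic _ _) fun k => ?_)
    -- Multiplication by z^k V sends zⁿR to z^{k+n} G, hence sends h into the closure of H^∞ G.
    -- Since Vh = ‖h‖, the image of h is a nonzero multiple of z^k, and so every monomial is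
    -- reached.
    have h1 := map_mem_of_mem_topologicalClosure_span
      (lpMul 2 (lpMul ⊤ (fourierLp ⊤ (k : ℤ)) V))
      (isClosed_cyclic (hardy ⊤ : Set (LSp ⊤)) G) (by
        rintro _ ⟨n, rfl⟩
        have e : lpMul 2 (lpMul ⊤ (fourierLp ⊤ (k : ℤ)) V) (lpMul 2 (fourierLp ⊤ (n : ℤ)) R) =
            lpMul 2 (fourierLp ⊤ ((k + n : ℕ) : ℤ)) G := by
          rw [hG, lpMul_assoc, ← lpMul_assoc ⊤, lpMul_comm V, lpMul_assoc ⊤,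
            lpMul_fourierLp_fourierLp, lpMul_assoc 2]
          push_cast
          rfl
        simp only
        rw [e]
        exact lpMul_mem_cyclic (fourierLp_mem_hardy ⊤ _) G) hS₀
    have e : (fourierLp 2 (k : ℤ) : LSp 2) =
        (‖h‖ : ℂ)⁻¹ • lpMul 2 (lpMul ⊤ (fourierLp ⊤ (k : ℤ)) V) h := by
      apply Lp.ext
      filter_upwards [Lp.coeFn_smul (‖h‖ : ℂ)⁻¹ (lpMul 2 (lpMul ⊤ (fourierLp ⊤ (k : ℤ)) V) h),
        lpMul_coe 2 (lpMul ⊤ (fourierLp ⊤ (k : ℤ)) V) h, lpMul_coe ⊤ (fourierLp ⊤ (k : ℤ)) V, hVc,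
        coeFn_fourierLp (T := 1) ⊤ k, coeFn_fourierLp (T := 1) 2 k, hconst] with
        t h2 h3 h4 h5 h6 h7 h8
      rw [h2, Pi.smul_apply, h3, h4, h5, h6, h7, smul_eq_mul]
      have h9 : conj (h t) * h t = (‖h‖ : ℂ) ^ 2 := by rw [Complex.conj_mul', h8]
      calc fourier (k : ℤ) t = (‖h‖ : ℂ)⁻¹ * (fourier (k : ℤ) t * ((‖h‖ : ℂ) ^ 2 / (‖h‖ : ℂ))) := by
            field_simp
        _ = _ := by rw [← h9]; ring
    rw [e]
    exact Submodule.smul_mem _ _ h1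
  · filter_upwards [hGc, hconst] with t h1 h2
    rw [h1, norm_mul, norm_div, Complex.norm_conj, h2, Complex.norm_real, Complex.norm_real,
      norm_norm, div_self (norm_ne_zero_iff.2 hne), one_mul, Real.norm_of_nonneg (hρ0 t).le]

/-! ### Duality between `L¹` and `L^∞` -/

theorem integrable_mul_lp_one (f : LSp ⊤) (ψ : LSp 1) : Integrable (fun t => f t * ψ t) arc := by
  have h : (lpMul 1 f ψ : Circ → ℂ) =ᵐ[arc] fun t => f t * ψ t := lpMul_coe 1 f ψ
  exact (lsp_integrable (lpMul 1 f ψ)).congr h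

theorem lpPairing_apply (f : LSp ⊤) (ψ : LSp 1) :
    (ContinuousLinearMap.mul ℂ ℂ).lpPairing arc ⊤ 1 f ψ = ∫ t, f t * ψ t ∂arc := by
  rw [ContinuousLinearMap.lpPairing_eq_integral]
  rfl

/-- The inclusion of `L²` in `L¹`. -/
def inclL2 : LSp 2 →L[ℂ] LSp 1 :=
  -- The inclusion is multiplication by the constant 1, viewed in L².
  (ContinuousLinearMap.mul ℂ ℂ).holderL arc 2 2 1 (fourierLp 2 0)

theorem inclL2_coe (u : LSp 2) : (inclL2 u : Circ → ℂ) =ᵐ[arc] u := by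
  filter_upwards [(ContinuousLinearMap.mul ℂ ℂ).coeFn_holder (r := 1) (fourierLp 2 0 : LSp 2) u,
    coeFn_fourierLp (T := 1) 2 0] with t h1 h2
  refine h1.trans ?_
  rw [h2, fourier_zero]
  exact one_mul _

/-- A vector of `L²` whose inner products are bounded by the `L¹`-norm is bounded. -/
theorem norm_ae_le_of_inner_le {r : LSp 2} {C : ℝ} (hC : 0 ≤ C)
    (h : ∀ u : LSp 2, ‖inner ℂ r u‖ ≤ C * ∫ t, ‖u t‖ ∂arc) : ∀ᵐ t ∂arc, ‖r t‖ ≤ C := by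
  have hr : Measurable fun t => ‖r t‖ := (Lp.stronglyMeasurable r).norm.measurable
  -- Testing the bound on the restriction of r to E gives ∫_E (|r|² − C|r|) ≤ 0 with a positive
  -- integrand on E, so E is null.
  set E : Set Circ := {t | C < ‖r t‖} with hE
  have hEm : MeasurableSet E := measurableSet_lt measurable_const hr
  have hum : MemLp (E.indicator (r : Circ → ℂ)) 2 arc := (Lp.memLp r).indicator hEm
  set u : LSp 2 := hum.toLp _
  have huc : (u : Circ → ℂ) =ᵐ[arc] E.indicator r := hum.coeFn_toLp
  have h1 : inner ℂ r u = ((∫ t in E, ‖r t‖ ^ 2 ∂arc : ℝ) : ℂ) := by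
    rw [L2.inner_def, ← integral_indicator hEm, ← integral_complex_ofReal]
    refine integral_congr_ae ?_
    filter_upwards [huc] with t ht
    rw [ht, RCLike.inner_apply]
    by_cases hte : t ∈ E
    · rw [Set.indicator_of_mem hte, Set.indicator_of_mem hte, Complex.mul_conj']
      push_cast
      rfl
    · rw [Set.indicator_of_notMem hte, Set.indicator_of_notMem hte, zero_mul, Complex.ofReal_zero]
  have h2 : ∫ t, ‖u t‖ ∂arc = ∫ t in E, ‖r t‖ ∂arc := by
    rw [← integral_indicator hEm]
    refine integral_congr_ae ?_
    filter_upwards [huc] with t ht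
    rw [ht, Set.indicator_apply, Set.indicator_apply]
    split_ifs <;> simp
  have h3 := h u
  rw [h1, h2, Complex.norm_real, Real.norm_of_nonneg (by positivity)] at h3
  have i1 : IntegrableOn (fun t => ‖r t‖ ^ 2) E arc := (integrable_norm_sq r).integrableOn
  have i2 : IntegrableOn (fun t => C * ‖r t‖) E arc :=
    ((lsp_integrable r).norm.const_mul C).integrableOn
  have h4 : ∫ t in E, (‖r t‖ ^ 2 - C * ‖r t‖) ∂arc ≤ 0 := by
    rw [integral_sub i1 i2, integral_const_mul]
    linarith
  have hnn : ∀ t ∈ E, 0 < ‖r t‖ ^ 2 - C * ‖r t‖ := fun t ht => by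
    have : C < ‖r t‖ := ht
    nlinarith
  have hnn' := (ae_restrict_iff' (μ := arc) hEm).2
    (Filter.Eventually.of_forall fun t ht => (hnn t ht).le)
  have h6 := le_antisymm h4 (integral_nonneg_of_ae hnn')
  rw [setIntegral_eq_zero_iff_of_nonneg_ae hnn' (i1.sub i2)] at h6
  filter_upwards [(ae_restrict_iff' hEm).1 h6] with t ht
  by_contra hlt
  exact (hnn t (not_le.1 hlt)).ne' (ht (not_le.1 hlt))

/-- Every bounded functional on `L¹` is given by a function in `L^∞`. -/
theorem exists_linf_of_dual (Λ : StrongDual ℂ (LSp 1)) :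
    ∃ f : LSp ⊤, ∀ ψ : LSp 1, Λ ψ = ∫ t, f t * ψ t ∂arc := by
  -- Restricted to L², the functional has a Riesz vector r; the L¹ bound makes r bounded. Density of
  -- continuous functions in L¹ extends the resulting formula.
  set r : LSp 2 := (InnerProductSpace.toDual ℂ (LSp 2)).symm (Λ.comp inclL2) with hr
  have hin : ∀ u, inner ℂ r u = Λ (inclL2 u) := fun u => InnerProductSpace.toDual_symm_apply
  have hb : ∀ᵐ t ∂arc, ‖r t‖ ≤ ‖Λ‖ := norm_ae_le_of_inner_le (norm_nonneg _) fun u => by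
    rw [hin]
    refine (Λ.le_opNorm _).trans_eq ?_
    rw [L1.norm_eq_integral_norm]
    congr 1
    refine integral_congr_ae ?_
    filter_upwards [inclL2_coe u] with t ht
    rw [ht]
  have hfm : MemLp (fun t => conj (r t)) ⊤ arc := by
    refine memLp_top_of_bound (C := ‖Λ‖) (Complex.continuous_conj.comp_aestronglyMeasurable
      (Lp.aestronglyMeasurable r)) ?_
    filter_upwards [hb] with t ht
    rwa [Complex.norm_conj]
  refine ⟨hfm.toLp _, fun ψ => ?_⟩
  rw [← lpPairing_apply]
  have hd : DenseRange (ContinuousMap.toLp (E := ℂ) 1 arc ℂ) :=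
    ContinuousMap.toLp_denseRange ℂ _ ℂ (by norm_num)
  refine congrFun (hd.equalizer Λ.continuous (ContinuousLinearMap.continuous _)
    (funext fun F => ?_)) ψ
  have e : ContinuousMap.toLp (E := ℂ) 1 arc ℂ F =
      inclL2 (ContinuousMap.toLp (E := ℂ) 2 arc ℂ F) := by
    apply Lp.ext
    filter_upwards [ContinuousMap.coeFn_toLp (E := ℂ) (p := 1) (𝕜 := ℂ) arc F,
      ContinuousMap.coeFn_toLp (E := ℂ) (p := 2) (𝕜 := ℂ) arc F,
      inclL2_coe (ContinuousMap.toLp (E := ℂ) 2 arc ℂ F)] with t h1 h2 h3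
    rw [h1, h3, h2]
  simp only [Function.comp_apply]
  rw [lpPairing_apply, e, ← hin, L2.inner_def]
  refine integral_congr_ae ?_
  filter_upwards [inclL2_coe (ContinuousMap.toLp (E := ℂ) 2 arc ℂ F), hfm.coeFn_toLp] with t h1 h2
  rw [h1, h2, RCLike.inner_apply, mul_comm]

/-- The pairing of `L^∞` and `L¹` as a bilinear form. -/
def pairing : LSp ⊤ →ₗ[ℂ] LSp 1 →ₗ[ℂ] ℂ :=
  (ContinuousLinearMap.coeLM ℂ).comp
    ((ContinuousLinearMap.mul ℂ ℂ).lpPairing arc ⊤ 1 : LSp ⊤ →ₗ[ℂ] LSp 1 →L[ℂ] ℂ)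

theorem pairing_apply (f : LSp ⊤) (ψ : LSp 1) : pairing f ψ = ∫ t, f t * ψ t ∂arc :=
  lpPairing_apply f ψ

/-- In this form convex separation applies, and the separating functional is known to come from L¹.
-/
theorem weakStar_eq : weakStar = (inferInstance : TopologicalSpace (WeakBilin pairing)) := by
  rw [weakStar]
  exact induced_compose

/-- A weak-star closed subspace is the annihilator of its preannihilator. -/
theorem mem_of_forall_preannihilator {B : Submodule ℂ (LSp ⊤)}
    (hB : IsClosed[weakStar] (B : Set (LSp ⊤))) {f : LSp ⊤}
    (h : ∀ ψ : LSp 1, (∀ b ∈ B, ∫ t, b t * ψ t ∂arc = 0) → ∫ t, f t * ψ t ∂arc = 0) : f ∈ B := by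
  by_contra hf
  rw [weakStar_eq] at hB
  let B' : Submodule ℂ (WeakBilin pairing) := B
  have hconv : Convex ℝ (B' : Set (WeakBilin pairing)) :=
    (B'.restrictScalars ℝ).convex
  obtain ⟨φ, u, h1, h2⟩ := RCLike.geometric_hahn_banach_closed_point (𝕜 := ℂ)
    (E := WeakBilin pairing) hconv hB (x := f) hf
  obtain ⟨ψ, rfl⟩ := LinearMap.dualEmbedding_surjective pairing φ
  have he : ∀ b : LSp ⊤, WeakBilin.eval pairing ψ b = ∫ t, b t * ψ t ∂arc := fun b =>
    pairing_apply b ψ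
  have hu : 0 < u := by simpa using h1 0 B'.zero_mem
  have h3 : ∀ b ∈ B, ∫ t, b t * ψ t ∂arc = 0 := fun b hb => by
    by_contra hne
    -- A nonzero value on a subspace can be rescaled to equal the separating constant u, which the
    -- strict inequality forbids.
    have h4 := h1 (((u : ℂ) / ∫ t, b t * ψ t ∂arc) • b) (B.smul_mem _ hb)
    rw [he, ← pairing_apply, map_smul, LinearMap.smul_apply, pairing_apply, smul_eq_mul, div_mul_cancel₀ _ hne] at h4
    exact lt_irrefl _ h4
  rw [he, h ψ h3] at h2
  simp at h2
  linarith

/-- A weak-star closed subspace contains the limits of its boundedly convergent sequences. -/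
theorem mem_of_tendsto_of_bounded {B : Submodule ℂ (LSp ⊤)}
    (hB : IsClosed[weakStar] (B : Set (LSp ⊤))) {f : LSp ⊤} {b : ℕ → LSp ⊤} (hb : ∀ n, b n ∈ B)
    {C : ℝ} (hC : ∀ n, ∀ᵐ t ∂arc, ‖b n t‖ ≤ C)
    (hlim : ∀ᵐ t ∂arc, Filter.Tendsto (fun n => b n t) Filter.atTop (𝓝 (f t))) : f ∈ B := by
  refine mem_of_forall_preannihilator hB fun ψ hψ => ?_
  have h1 : Filter.Tendsto (fun n => ∫ t, b n t * ψ t ∂arc) Filter.atTop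
      (𝓝 (∫ t, f t * ψ t ∂arc)) := by
    refine tendsto_integral_of_dominated_convergence (fun t => C * ‖ψ t‖)
      (fun n => (integrable_mul_lp_one _ _).aestronglyMeasurable)
      ((lsp_integrable ψ).norm.const_mul C) (fun n => ?_) ?_
    · filter_upwards [hC n] with t ht
      rw [norm_mul]
      gcongr
    · filter_upwards [hlim] with t ht
      exact ht.mul_const _
  simp only [hψ _ (hb _)] at h1
  exact tendsto_nhds_unique h1 tendsto_const_nhds

/-! ### Elements of the algebra are measurable for its σ-algebra -/

/-- Polynomials that converge boundedly on `[-M, M]` to the indicator function of `(c, ∞)`. -/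
theorem exists_polynomial_tendsto_indicator (M c : ℝ) : ∃ p : ℕ → Polynomial ℝ,
    (∀ n, ∀ x ∈ Set.Icc (-M) M, |(p n).eval x| ≤ 2) ∧
    ∀ x ∈ Set.Icc (-M) M, Filter.Tendsto (fun n => (p n).eval x) Filter.atTop
      (𝓝 (if c < x then 1 else 0)) := by
  -- Continuous ramps with values in [0, 1] that converge to the indicator. Approximating the n-th
  -- within 1/(n+1) ≤ 1 yields the uniform bound 2.
  set φ : ℕ → ℝ → ℝ := fun n x => min 1 (n * max (x - c) 0) with hφ
  have hφ0 : ∀ n x, 0 ≤ φ n x := fun n x => by positivity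
  have hφ1 : ∀ n x, φ n x ≤ 1 := fun n x => min_le_left _ _
  choose p hp using fun n : ℕ => exists_polynomial_near_of_continuousOn (-M) M (φ n)
    (by fun_prop) (1 / ((n : ℝ) + 1)) (by positivity)
  have hn1 : ∀ n : ℕ, 1 / ((n : ℝ) + 1) ≤ 1 := fun n => by
    rw [div_le_one (by positivity)]
    linarith [(Nat.cast_nonneg n : (0 : ℝ) ≤ n)]
  refine ⟨p, fun n x hx => ?_, fun x hx => ?_⟩
  · have h1 := abs_lt.1 (hp n x hx)
    rw [abs_le]
    constructor <;> linarith [h1.1, h1.2, hφ0 n x, hφ1 n x, hn1 n]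
  · have hlim : Filter.Tendsto (fun n => φ n x) Filter.atTop (𝓝 (if c < x then 1 else 0)) := by
      split_ifs with h
      · obtain ⟨N, hN⟩ := exists_nat_gt (1 / (x - c))
        have hpos : 0 < x - c := by linarith
        refine tendsto_const_nhds.congr' ?_
        filter_upwards [Filter.eventually_ge_atTop N] with n hn
        have h2 : (N : ℝ) ≤ n := by exact_mod_cast hn
        rw [hφ]
        simp only
        rw [max_eq_left hpos.le, min_eq_left]
        rw [← div_le_iff₀ hpos]
        linarith
      · have : ∀ n, φ n x = 0 := fun n => by
          simp only [hφ]
          rw [max_eq_right (by linarith), mul_zero]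
          exact min_eq_right zero_le_one
        simp only [this]
        exact tendsto_const_nhds
    have hdiff : Filter.Tendsto (fun n => (p n).eval x - φ n x) Filter.atTop (𝓝 0) := by
      refine squeeze_zero_norm (fun n => ?_) (tendsto_one_div_add_atTop_nhds_zero_nat (𝕜 := ℝ))
      exact (hp n x hx).le
    simpa using hdiff.add hlim

theorem IsUnitalSubalg.exists_polynomial {B : Submodule ℂ (LSp ⊤)} (hB : IsUnitalSubalg B)
    {u : LSp ⊤} (hu : u ∈ B) {a : Circ → ℝ} (hua : (u : Circ → ℂ) =ᵐ[arc] fun t => (a t : ℂ))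
    (p : Polynomial ℝ) :
    ∃ v ∈ B, (v : Circ → ℂ) =ᵐ[arc] fun t => ((p.eval (a t) : ℝ) : ℂ) := by
  induction p using Polynomial.induction_on' with
  | add p q hp hq =>
    obtain ⟨v, hv, hvc⟩ := hp
    obtain ⟨w, hw, hwc⟩ := hq
    refine ⟨v + w, B.add_mem hv hw, ?_⟩
    filter_upwards [Lp.coeFn_add v w, hvc, hwc] with t h1 h2 h3
    rw [h1, Pi.add_apply, h2, h3, Polynomial.eval_add, Complex.ofReal_add]
  | monomial n c =>
    induction n with
    | zero =>
      refine ⟨(c : ℂ) • oneInf, B.smul_mem _ hB.1, ?_⟩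
      filter_upwards [Lp.coeFn_smul (c : ℂ) oneInf, oneInf_coe] with t h1 h2
      rw [h1, Pi.smul_apply, h2]
      simp
    | succ n ih =>
      obtain ⟨v, hv, hvc⟩ := ih
      refine ⟨lpMul ⊤ v u, hB.2 v hv u hu, ?_⟩
      filter_upwards [lpMul_coe ⊤ v u, hvc, hua] with t h1 h2 h3
      rw [h1, h2, h3]
      simp only [Polynomial.eval_monomial]
      push_cast
      ring

/-- A weak-star closed unital subalgebra of `L^∞` contains the indicator functions of the sets
`{c < u}` for its real elements `u`. -/
theorem IsUnitalSubalg.exists_indicator {B : Submodule ℂ (LSp ⊤)} (hB : IsUnitalSubalg B)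
    (hBc : IsClosed[weakStar] (B : Set (LSp ⊤))) {u : LSp ⊤} (hu : u ∈ B) {a : Circ → ℝ}
    (ha : Measurable a) (hua : (u : Circ → ℂ) =ᵐ[arc] fun t => (a t : ℂ)) (c : ℝ) :
    ∃ f ∈ B, (f : Circ → ℂ) =ᵐ[arc] {t | c < a t}.indicator fun _ => 1 := by
  have hE : MeasurableSet {t | c < a t} := measurableSet_lt measurable_const ha
  have hbd : ∀ᵐ t ∂arc, a t ∈ Set.Icc (-‖u‖) ‖u‖ := by
    have h1 : ∀ᵐ t ∂arc, ‖u t‖ ≤ ‖u‖ := by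
      have h2 := ae_le_eLpNormEssSup (f := (u : Circ → ℂ)) (μ := arc)
      filter_upwards [h2] with t ht
      have h3 := ENNReal.toReal_mono (by
        rw [← eLpNorm_exponent_top]
        exact Lp.eLpNorm_ne_top u) ht
      rw [Lp.norm_def, eLpNorm_exponent_top]
      simpa using h3
    filter_upwards [h1, hua] with t h2 h3
    rw [h3, Complex.norm_real, Real.norm_eq_abs] at h2
    exact abs_le.1 h2
  obtain ⟨p, hp2, hplim⟩ := exists_polynomial_tendsto_indicator ‖u‖ c
  choose v hv hvc using fun n => hB.exists_polynomial hu hua (p n)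
  have hm : MemLp ({t | c < a t}.indicator fun _ => (1 : ℂ)) ⊤ arc :=
    (memLp_const 1).indicator hE
  refine ⟨hm.toLp _, ?_, hm.coeFn_toLp⟩
  refine mem_of_tendsto_of_bounded hBc hv (C := 2) (fun n => ?_) ?_
  · filter_upwards [hvc n, hbd] with t h1 h2
    rw [h1, Complex.norm_real, Real.norm_eq_abs]
    exact hp2 n _ h2
  · filter_upwards [ae_all_iff.2 hvc, hbd, hm.coeFn_toLp] with t h1 h2 h3
    rw [h3]
    simp only [h1]
    have h4 := (Complex.continuous_ofReal.tendsto _).comp (hplim _ h2)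
    have h5 : {t | c < a t}.indicator (fun _ => (1 : ℂ)) t =
        ((if c < a t then 1 else 0 : ℝ) : ℂ) := by
      by_cases h : c < a t <;> simp [h]
    rw [h5]
    exact h4

namespace HinfSubalg

variable (A : HinfSubalg)

theorem sigma_le : A.sigma ≤ (inferInstance : MeasurableSpace Circ) :=
  MeasurableSpace.generateFrom_le fun _ hE => hE.1

theorem isUnitalSubalg_LinfGen : IsUnitalSubalg A.LinfGen := by
  refine ⟨?_, fun f hf g hg => ?_⟩
  · rw [LinfGen, Submodule.mem_sInf]
    exact fun B hB => hB.1.1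
  · rw [LinfGen, Submodule.mem_sInf] at hf hg ⊢
    exact fun B hB => hB.1.2 f (hf B hB) g (hg B hB)

theorem isClosed_LinfGen : IsClosed[weakStar] (A.LinfGen : Set (LSp ⊤)) := by
  rw [LinfGen, Submodule.coe_sInf]
  exact @isClosed_biInter _ _ weakStar _ _ fun B hB => hB.2.1

theorem mem_LinfGen {f : LSp ⊤} (hf : f ∈ A.carrier) : f ∈ A.LinfGen := by
  rw [LinfGen, Submodule.mem_sInf]
  exact fun B hB => (hB.2.2 f hf).1

theorem star_mem_LinfGen {f : LSp ⊤} (hf : f ∈ A.carrier) : star f ∈ A.LinfGen := by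
  rw [LinfGen, Submodule.mem_sInf]
  exact fun B hB => (hB.2.2 f hf).2

/-- The sets {c < a} are themselves generators of `A.sigma`, so a is measurable as it stands,
without a change on a null set. -/
theorem measurable_sigma {u : LSp ⊤} (hu : u ∈ A.LinfGen) {a : Circ → ℝ} (ha : Measurable a)
    (hua : (u : Circ → ℂ) =ᵐ[arc] fun t => (a t : ℂ)) : Measurable[A.sigma] a := by
  refine @measurable_of_Ioi _ _ _ _ _ A.sigma _ _ _ _ fun c => ?_
  exact MeasurableSpace.measurableSet_generateFrom ⟨ha measurableSet_Ioi,
    A.isUnitalSubalg_LinfGen.exists_indicator A.isClosed_LinfGen hu ha hua c⟩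

/-- The real and imaginary parts of f are combinations of f and `star f`, hence real elements of
L^∞(A). This is what lets f be pulled out of conditional expectations. -/
theorem aestronglyMeasurable_sigma {f : LSp ⊤} (hf : f ∈ A.carrier) :
    AEStronglyMeasurable[A.sigma] (f : Circ → ℂ) arc := by
  have hfm : Measurable (f : Circ → ℂ) := (Lp.stronglyMeasurable f).measurable
  have hre : Measurable[A.sigma] fun t => (f t).re := by
    refine A.measurable_sigma (u := (1 / 2 : ℂ) • (f + star f)) (Submodule.smul_mem _ _
      (Submodule.add_mem _ (A.mem_LinfGen hf) (A.star_mem_LinfGen hf)))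
      (Complex.measurable_re.comp hfm) ?_
    filter_upwards [Lp.coeFn_smul (1 / 2 : ℂ) (f + star f), Lp.coeFn_add f (star f),
      Lp.coeFn_star f] with t h1 h2 h3
    rw [h1, Pi.smul_apply, h2, Pi.add_apply, h3, Pi.star_apply, smul_eq_mul, Complex.re_eq_add_conj]
    simp only [RCLike.star_def]
    ring
  have him : Measurable[A.sigma] fun t => (f t).im := by
    refine A.measurable_sigma (u := (1 / (2 * Complex.I) : ℂ) • (f - star f)) (Submodule.smul_mem _ _
      (Submodule.sub_mem _ (A.mem_LinfGen hf) (A.star_mem_LinfGen hf)))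
      (Complex.measurable_im.comp hfm) ?_
    filter_upwards [Lp.coeFn_smul (1 / (2 * Complex.I) : ℂ) (f - star f), Lp.coeFn_sub f (star f),
      Lp.coeFn_star f] with t h1 h2 h3
    rw [h1, Pi.smul_apply, h2, Pi.sub_apply, h3, Pi.star_apply, smul_eq_mul, Complex.im_eq_sub_conj]
    simp only [RCLike.star_def]
    ring
  have h : Measurable[A.sigma] (f : Circ → ℂ) := by
    have := (Complex.measurable_ofReal.comp hre).add
      ((Complex.measurable_ofReal.comp him).mul_const Complex.I)
    convert this using 1
    funext t
    exact (Complex.re_add_im (f t)).symm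
  exact h.stronglyMeasurable.aestronglyMeasurable

end HinfSubalg

/-! ### Factorization of vector valued integrable functions -/

/-- The `k`-th coordinate of a vector in `ℓ²`. -/
abbrev coord (k : ℕ) : ell2 →L[ℂ] ℂ := lp.evalCLM ℂ (fun _ : ℕ => ℂ) 2 k

theorem sum_norm_sq_le_ell2 (s : Finset ℕ) (u : ell2) : ∑ k ∈ s, ‖u k‖ ^ 2 ≤ ‖u‖ ^ 2 := by
  simpa using lp.sum_rpow_le_norm_rpow (p := 2) (by norm_num) u s

namespace HinfSubalg

variable (A : HinfSubalg)

/-- Against elements of `A`, an integrable function may be replaced by its conditional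
expectation. -/
theorem integral_mul_condExp {f : LSp ⊤} (hf : f ∈ A.carrier) {Ψ : Circ → ell2}
    (hΨ : Integrable Ψ arc) (k : ℕ) :
    ∫ t, f t * (arc[Ψ | A.sigma]) t k ∂arc = ∫ t, f t * Ψ t k ∂arc := by
  have hk : Integrable (fun t => Ψ t k) arc := (coord k).integrable_comp hΨ
  have h1 : ((coord k).restrictScalars ℝ) ∘ arc[Ψ | A.sigma] =ᵐ[arc]
      arc[((coord k).restrictScalars ℝ) ∘ Ψ | A.sigma] :=
    ContinuousLinearMap.comp_condExp_comm hΨ ((coord k).restrictScalars ℝ)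
  have hfk : Integrable (fun t => f t * Ψ t k) arc :=
    (integrable_mul_lp_one f (MemLp.toLp _ (memLp_one_iff_integrable.2 hk))).congr (by
      filter_upwards [MemLp.coeFn_toLp (memLp_one_iff_integrable.2 hk)] with t ht
      rw [ht])
  have h2 := condExp_bilin_of_aestronglyMeasurable_left (ContinuousLinearMap.mul ℝ ℂ)
    (A.aestronglyMeasurable_sigma hf) hfk hk
  rw [← integral_condExp A.sigma_le (f := fun t => f t * Ψ t k)]
  refine integral_congr_ae ?_
  filter_upwards [h1, h2] with t h3 h4
  refine Eq.trans ?_ h4.symm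
  rw [ContinuousLinearMap.mul_apply']
  congr 1

/-- An L¹ function is split into two L² factors, one of them an admissible g. Conditioning on the
σ-algebra of A makes |g| measurable for it, and neither changes the pairings with A nor increases
the norm. -/
theorem exists_admissible_factorization (Ψ : Lp ell2 1 arc) {ε : ℝ} (hε : 0 < ε) :
    ∃ g : H2, A.Admissible g ∧ ∃ η : ℕ → LSp 2,
      (∀ f ∈ A.carrier, ∀ k, ∫ t, f t * Ψ t k ∂arc = inner ℂ (η k) (lpMul 2 f g)) ∧
      ∀ s : Finset ℕ, ∑ k ∈ s, ‖η k‖ ^ 2 ≤ (‖Ψ‖ + ε) ^ 2 := by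
  have hΨ : Integrable (Ψ : Circ → ell2) arc := L1.integrable_coeFn Ψ
  set Φ : Circ → ell2 := arc[Ψ | A.sigma] with hΦ
  have hΦσ : StronglyMeasurable[A.sigma] Φ := stronglyMeasurable_condExp
  have hΦm : StronglyMeasurable Φ := hΦσ.mono A.sigma_le
  have hΦi : Integrable Φ arc := integrable_condExp
  set N : ℝ := ∫ t, ‖Φ t‖ ∂arc with hN
  have hN0 : 0 ≤ N := integral_nonneg fun t => norm_nonneg _
  have hNΨ : N ≤ ‖Ψ‖ := by
    rw [L1.norm_eq_integral_norm]
    exact integral_norm_condExp_le _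
  -- The denominator makes ∫ρ² = 1; the ε in the numerator keeps ρ bounded below, as the
  -- construction of the outer function requires.
  set ρ : Circ → ℝ := fun t => √((‖Φ t‖ + ε) / (N + ε)) with hρ
  have hρsq : ∀ t, ρ t ^ 2 = (‖Φ t‖ + ε) / (N + ε) := fun t => Real.sq_sqrt (by positivity)
  have hρσ : StronglyMeasurable[A.sigma] ρ :=
    ((Real.continuous_sqrt.comp (by fun_prop : Continuous fun x : ℝ => (x + ε) / (N + ε))
      ).comp_stronglyMeasurable hΦσ.norm)
  have hρm : StronglyMeasurable ρ := hρσ.mono A.sigma_le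
  have hρi : Integrable (fun t => ρ t ^ 2) arc := by
    simp only [hρsq]
    exact (hΦi.norm.add (integrable_const ε)).div_const _
  have hρ2 : MemLp ρ 2 arc := (memLp_two_iff_integrable_sq hρm.aestronglyMeasurable).2 hρi
  have hρpos : ∀ t, 0 < ρ t := fun t => Real.sqrt_pos.2 (by positivity)
  obtain ⟨g, hg, hgρ⟩ := exists_isOuter_norm_eq hρ2 (c := √(ε / (N + ε)))
    (Real.sqrt_pos.2 (by positivity)) fun t => Real.sqrt_le_sqrt (by
      gcongr
      linarith [norm_nonneg (Φ t)])
  have hgn : ‖g‖ = 1 := by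
    have h1 := norm_sq_eq_integral (g : LSp 2)
    have h2 : ∫ t, ‖(g : LSp 2) t‖ ^ 2 ∂arc = 1 := by
      rw [integral_congr_ae (g := fun t => (‖Φ t‖ + ε) / (N + ε)) (by
        filter_upwards [hgρ] with t ht
        rw [ht, hρsq]), integral_div, integral_add hΦi.norm (integrable_const ε), ← hN]
      simp only [integral_const, probReal_univ, one_smul]
      exact div_self (by positivity)
    rw [h2] at h1
    exact (pow_eq_one_iff_of_nonneg (norm_nonneg _) two_ne_zero).1 h1
  -- Here η_k = conj(Φ_k / g), and ‖Φ‖² / |g|² = (N + ε) ‖Φ‖² / (‖Φ‖ + ε) ≤ (N + ε) ‖Φ‖. The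
  -- integral is at most (N + ε) N.
  have hηb : ∀ᵐ t ∂arc, ∀ s : Finset ℕ,
      ∑ k ∈ s, ‖conj (Φ t k / (g : LSp 2) t)‖ ^ 2 ≤ (N + ε) * ‖Φ t‖ := by
    filter_upwards [hgρ] with t ht s
    simp only [Complex.norm_conj, norm_div, ht, div_pow, hρsq]
    rw [← Finset.sum_div]
    calc _ ≤ ‖Φ t‖ ^ 2 / ((‖Φ t‖ + ε) / (N + ε)) := by
          gcongr
          exact sum_norm_sq_le_ell2 s (Φ t)
      _ = (N + ε) * (‖Φ t‖ * ‖Φ t‖ / (‖Φ t‖ + ε)) := by field_simp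
      _ ≤ (N + ε) * ‖Φ t‖ := by
          gcongr
          rw [div_le_iff₀ (by positivity)]
          nlinarith [norm_nonneg (Φ t)]
  have hηmeas : ∀ k, AEStronglyMeasurable (fun t => conj (Φ t k / (g : LSp 2) t)) arc := fun k =>
    Complex.continuous_conj.comp_aestronglyMeasurable
      ((((coord k).continuous.comp_stronglyMeasurable hΦm).measurable.div
        (Lp.stronglyMeasurable (g : LSp 2)).measurable).aestronglyMeasurable)
  have hηm : ∀ k, MemLp (fun t => conj (Φ t k / (g : LSp 2) t)) 2 arc := fun k => by
    rw [memLp_two_iff_integrable_sq_norm (hηmeas k)]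
    refine (hΦi.norm.const_mul (N + ε)).mono' ((hηmeas k).norm.pow 2) ?_
    filter_upwards [hηb] with t ht
    rw [Real.norm_of_nonneg (by positivity)]
    simpa using ht {k}
  refine ⟨g, ⟨hg, ⟨(Lp.memLp (g : LSp 2)).norm, ⟨ρ, hρσ, hgρ⟩⟩, hgn⟩,
    fun k => (hηm k).toLp _, fun f hf k => ?_, fun s => ?_⟩
  · rw [← A.integral_mul_condExp hf hΨ k, L2.inner_def]
    refine integral_congr_ae ?_
    filter_upwards [(hηm k).coeFn_toLp, lpMul_coe 2 f (g : LSp 2), hgρ] with t h1 h2 h3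
    have hne : (g : LSp 2) t ≠ 0 := norm_pos_iff.1 (h3 ▸ hρpos t)
    rw [h1, h2, RCLike.inner_apply, Complex.conj_conj]
    field_simp
    rfl
  · simp only [norm_sq_eq_integral]
    rw [← integral_finsetSum _ fun k _ => integrable_norm_sq _]
    calc _ ≤ ∫ t, (N + ε) * ‖Φ t‖ ∂arc := by
          refine integral_mono_ae (integrable_finsetSum _ fun k _ => integrable_norm_sq _)
            (hΦi.norm.const_mul _) ?_
          filter_upwards [hηb, ae_all_iff.2 fun k => (hηm k).coeFn_toLp] with t h1 h2
          simp only [h2]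
          exact h1 s
      _ = (N + ε) * N := integral_const_mul _ _
      _ ≤ (‖Ψ‖ + ε) ^ 2 := by nlinarith [norm_nonneg Ψ]

end HinfSubalg

/-! ### The interpolation theorem -/

/-- A form of the Hahn–Banach theorem: interpolation of prescribed values by a functional that
vanishes on a given subspace. -/
theorem exists_dual_of_bound {X ι : Type*} [NormedAddCommGroup X] [NormedSpace ℂ X] (Ψ : ι → X)
    (w : ι → ℂ) (N : Submodule ℂ X) {α : ℝ} (hα : 0 ≤ α)
    (h : ∀ (s : Finset ι) (c : ι → ℂ), ∀ n ∈ N,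
      ‖∑ i ∈ s, c i * w i‖ ≤ α * ‖∑ i ∈ s, c i • Ψ i + n‖) :
    ∃ Λ : StrongDual ℂ X, ‖Λ‖ ≤ α ∧ (∀ n ∈ N, Λ n = 0) ∧ ∀ i, Λ (Ψ i) = w i := by
  classical
  let T : (ι →₀ ℂ) × N →ₗ[ℂ] X := (Finsupp.linearCombination ℂ Ψ).coprod N.subtype
  let μ : (ι →₀ ℂ) × N →ₗ[ℂ] ℂ := (Finsupp.linearCombination ℂ w).comp (LinearMap.fst ℂ _ _)
  have hb : ∀ y, ‖μ y‖ ≤ α * ‖T y‖ := fun y => by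
    simpa [T, μ, Finsupp.linearCombination_apply, Finsupp.sum] using
      h y.1.support y.1 y.2 y.2.2
  -- The bound forces μ to vanish on the kernel of T, so μ descends to a functional on the range of
  -- T, bounded by α.
  have hμ : μ ∈ T.ker.dualAnnihilator := by
    rw [Submodule.mem_dualAnnihilator]
    intro y hy
    have h1 := hb y
    rw [LinearMap.mem_ker.1 hy, norm_zero, mul_zero] at h1
    exact norm_le_zero_iff.1 h1
  rw [← LinearMap.range_dualMap_eq_dualAnnihilator_ker] at hμ
  obtain ⟨l, hl⟩ := hμ
  have hl' : ∀ y, l (T y) = μ y := fun y => LinearMap.congr_fun hl y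
  let lc : StrongDual ℂ T.range := (l.comp T.range.subtype).mkContinuous α (by
    rintro ⟨_, y, rfl⟩
    have h1 := hb y
    rw [← hl' y] at h1
    exact h1)
  obtain ⟨Λ, hΛ, hn⟩ := exists_extension_norm_eq T.range lc
  have hΛT : ∀ y, Λ (T y) = μ y := fun y =>
    (hΛ ⟨T y, LinearMap.mem_range_self T y⟩).trans (hl' y)
  refine ⟨Λ, hn.trans_le (LinearMap.mkContinuous_norm_le _ hα _), fun n hn => ?_, fun i => ?_⟩
  · simpa [T, μ] using hΛT (0, ⟨n, hn⟩)
  · simpa [T, μ] using hΛT (Finsupp.single i 1, 0)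

/-- The function `t ↦ ψ(t) u` with values in `ℓ²`. -/
def tens (u : ell2) : LSp 1 →L[ℂ] Lp ell2 1 arc :=
  (ContinuousLinearMap.toSpanSingleton ℂ u).compLpL 1 arc

theorem tens_coe (u : ell2) (ψ : LSp 1) : (tens u ψ : Circ → ell2) =ᵐ[arc] fun t => ψ t • u :=
  ContinuousLinearMap.coeFn_compLpL _ _

theorem norm_tens_le (u : ell2) (ψ : LSp 1) : ‖tens u ψ‖ ≤ ‖u‖ * ‖ψ‖ := by
  refine ((tens u).le_opNorm ψ).trans ?_
  gcongr
  refine (ContinuousLinearMap.norm_compLpL_le _).trans_eq ?_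
  rw [ContinuousLinearMap.norm_toSpanSingleton]

theorem tens_add (u v : ell2) (ψ : LSp 1) : tens (u + v) ψ = tens u ψ + tens v ψ := by
  apply Lp.ext
  filter_upwards [tens_coe (u + v) ψ, tens_coe u ψ, tens_coe v ψ,
    Lp.coeFn_add (tens u ψ) (tens v ψ)] with t h1 h2 h3 h4
  rw [h1, h4, Pi.add_apply, h2, h3, smul_add]

theorem tens_smul (c : ℂ) (u : ell2) (ψ : LSp 1) : tens (c • u) ψ = c • tens u ψ := by
  apply Lp.ext
  filter_upwards [tens_coe (c • u) ψ, tens_coe u ψ, Lp.coeFn_smul c (tens u ψ)] with t h1 h2 h3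
  rw [h1, h3, Pi.smul_apply, h2, smul_comm]

/-- The functional `Ψ ↦ ∫ f Ψ_k`. -/
def coordPair (f : LSp ⊤) (k : ℕ) : Lp ell2 1 arc →L[ℂ] ℂ :=
  ((ContinuousLinearMap.mul ℂ ℂ).lpPairing arc ⊤ 1 f).comp ((coord k).compLpL 1 arc)

theorem coordPair_apply (f : LSp ⊤) (k : ℕ) (Ψ : Lp ell2 1 arc) :
    coordPair f k Ψ = ∫ t, f t * Ψ t k ∂arc := by
  rw [coordPair, ContinuousLinearMap.comp_apply, lpPairing_apply]
  refine integral_congr_ae ?_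
  filter_upwards [(coord k).coeFn_compLpL Ψ] with t ht
  rw [ht]
  rfl

theorem coordPair_tens (f : LSp ⊤) (k : ℕ) (u : ell2) (ψ : LSp 1) :
    coordPair f k (tens u ψ) = u k * ∫ t, f t * ψ t ∂arc := by
  rw [coordPair_apply, ← integral_const_mul]
  refine integral_congr_ae ?_
  filter_upwards [tens_coe u ψ] with t ht
  rw [ht, lp.coeFn_smul, Pi.smul_apply, smul_eq_mul]
  ring

/-! ### Columns as functionals on L¹(ℓ²), and reduction to kernel functions of H_g. -/

namespace HinfSubalg

variable (A : HinfSubalg)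

/-- The functions `Ψ` such that `∫ f Ψ_k = 0` for all `f ∈ A` and all `k`. -/
def preann : Submodule ℂ (Lp ell2 1 arc) :=
  ⨅ (f : A.carrier) (k : ℕ), (coordPair f k : Lp ell2 1 arc →ₗ[ℂ] ℂ).ker

theorem mem_preann {Ψ : Lp ell2 1 arc} :
    Ψ ∈ A.preann ↔ ∀ f ∈ A.carrier, ∀ k, coordPair f k Ψ = 0 := by
  simp [preann, Submodule.mem_iInf]

/-- A bounded functional on `L¹(ℓ²)` that vanishes on the preannihilator of the columns is given by
a column. -/
theorem exists_col_of_dual {Λ : StrongDual ℂ (Lp ell2 1 arc)} {α : ℝ} (hΛ : ‖Λ‖ ≤ α)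
    (h0 : ∀ Ψ ∈ A.preann, Λ Ψ = 0) : ∃ F : A.Col, (⨆ z : Disk, ‖F.val z‖) ≤ α ∧
      ∀ (z : Disk) (u : ell2), HasSum (fun k => u k * F.val z k) (Λ (tens u (poisson z))) := by
  choose f hf using fun k : ℕ =>
    exists_linf_of_dual (Λ.comp (tens (lp.single 2 k (1 : ℂ))))
  have hfA : ∀ k, f k ∈ A.carrier := fun k => by
    refine mem_of_forall_preannihilator A.closed fun ψ hψ => ?_
    rw [← hf k ψ]
    refine h0 _ (A.mem_preann.2 fun b hb j => ?_)
    exact (coordPair_tens b j _ ψ).trans (by rw [hψ b hb, mul_zero])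
  have hα : 0 ≤ α := (norm_nonneg _).trans hΛ
  -- For fixed z this functional on ℓ² has norm at most α, and its value at the k-th unit vector is
  -- f_k(z). The conjugate of its Riesz vector is thus (f_k(z))_k, which bounds the column.
  let τ : Disk → ell2 →L[ℂ] ℂ := fun z => LinearMap.mkContinuous
    { toFun := fun u => Λ (tens u (poisson z))
      map_add' := fun u v => by rw [tens_add, map_add]
      map_smul' := fun c u => by rw [tens_smul, map_smul, RingHom.id_apply] }
    α (fun u => by
      refine (Λ.le_opNorm _).trans ?_
      exact mul_le_mul hΛ ((norm_tens_le u _).trans_eq (by rw [norm_poisson, mul_one]))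
        (norm_nonneg _) hα)
  have hτn : ∀ z, ‖τ z‖ ≤ α := fun z => LinearMap.mkContinuous_norm_le _ hα _
  have hτ : ∀ z k, τ z (lp.single 2 k (1 : ℂ)) = diskEval (f k) z := fun z k => by
    rw [← integral_mul_poisson (A.le_hardy (hfA k)) z, ← hf k]
    rfl
  set r : Disk → ell2 := fun z => (InnerProductSpace.toDual ℂ ell2).symm (τ z) with hr
  have hrn : ∀ z, ‖r z‖ ≤ α := fun z => by
    rw [hr]
    simpa using hτn z
  have hrk : ∀ z k, (star (r z)) k = diskEval (f k) z := fun z k => by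
    rw [← hτ, ← InnerProductSpace.toDual_symm_apply (𝕜 := ℂ) (y := τ z), lp.inner_single_right]
    simp [hr]
  have hval : ∀ z, (fun k => diskEval (f k) z) = (star (r z) : ell2) := fun z =>
    funext fun k => (hrk z k).symm
  have hmem : ∀ z, Memℓp (fun k => diskEval (f k) z) 2 := fun z => by
    rw [hval]
    exact lp.memℓp _
  have hnorm : ∀ z, ‖(⟨fun k => diskEval (f k) z, hmem z⟩ : ell2)‖ ≤ α := fun z => by
    have e : (⟨fun k => diskEval (f k) z, hmem z⟩ : ell2) = star (r z) := lp.ext (hval z)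
    rw [e, norm_star]
    exact hrn z
  refine ⟨⟨f, hfA, hmem, ⟨α, ?_⟩⟩, ciSup_le hnorm, fun z u => ?_⟩
  · rintro _ ⟨z, rfl⟩
    exact hnorm z
  · have h1 := (lp.hasSum_single (by norm_num) u).mapL (τ z)
    refine h1.congr_fun fun k => ?_
    have e : lp.single 2 k (u k) = u k • (lp.single 2 k (1 : ℂ) : ell2) := by
      rw [← lp.single_smul]
      simp
    rw [e, map_smul, hτ]
    rfl

/-- The kernel function of `H_g` at `x`, as a vector of `L²`. -/
def ker (g : H2) (x : Disk) : LSp 2 := (RKHS.kerFun (A.Hg g) x (1 : ℂ) : A.Hg g)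

theorem ker_mem (g : H2) (x : Disk) : A.ker g x ∈ A.Hg g :=
  (RKHS.kerFun (A.Hg g) x (1 : ℂ) : A.Hg g).2

theorem inner_ker (g : H2) (x : Disk) {h : LSp 2} (hh : h ∈ A.Hg g) :
    inner ℂ (A.ker g x) h = evalCLM x h := by
  have h1 := RKHS.kerFun_inner x (1 : ℂ) (⟨h, hh⟩ : A.Hg g)
  rw [RCLike.inner_apply, map_one (starRingEnd ℂ), mul_one] at h1
  exact h1

theorem mem_Hg_self (g : H2) : (g : LSp 2) ∈ A.Hg g := by
  have h := lpMul_mem_cyclic (S := (A.carrier : Set (LSp ⊤))) A.unital_subalg.1 (g : LSp 2)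
  rwa [lpMul_oneInf] at h

/-- Interpolation by columns: it is enough to have norm estimates for combinations of the kernel
functions of all spaces `H_g`. -/
theorem exists_col_of_ker_bound {ι : Type*} (x : ι → Disk) (u : ι → ell2) (w : ι → ℂ) {α : ℝ}
    (hα : 0 ≤ α)
    (h : ∀ g, A.Admissible g → ∀ (s : Finset ι) (a : ι → ℂ) (C : ℝ), 0 ≤ C →
      (∀ q : Finset ℕ, ∑ k ∈ q, ‖∑ i ∈ s, (a i * (starRingEnd ℂ) (u i k)) • A.ker g (x i)‖ ^ 2 ≤ C ^ 2) →
      ‖∑ i ∈ s, (a i * conj (w i)) • A.ker g (x i)‖ ≤ α * C) :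
    ∃ F : A.Col, (⨆ z : Disk, ‖F.val z‖) ≤ α ∧
      ∀ i, HasSum (fun k => u i k * F.val (x i) k) (w i) := by
  obtain ⟨Λ, hΛ, hΛ0, hΛw⟩ := exists_dual_of_bound (fun i => tens (u i) (poisson (x i))) w A.preann
    hα (fun s c n hn => by
      set Ψ := ∑ i ∈ s, c i • tens (u i) (poisson (x i)) + n with hΨ
      have hpair : ∀ f ∈ A.carrier, ∀ k, ∫ t, f t * Ψ t k ∂arc =
          ∑ i ∈ s, c i * (u i k * diskEval f (x i)) := fun f hf k => by
        rw [← coordPair_apply, hΨ, map_add, A.mem_preann.1 hn f hf k, add_zero, map_sum]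
        refine Finset.sum_congr rfl fun i _ => ?_
        rw [map_smul, coordPair_tens, integral_mul_poisson (A.le_hardy hf), smul_eq_mul]
      have hε : ∀ ε : ℝ, 0 < ε → ‖∑ i ∈ s, c i * w i‖ ≤ α * (‖Ψ‖ + ε) := fun ε hε => by
        obtain ⟨g, hg, η, hη, hηn⟩ := A.exists_admissible_factorization Ψ hε
        have hg0 : ∀ z, evalCLM z (g : LSp 2) ≠ 0 := hg.1.evalCLM_ne_zero
        -- Dividing by g(x_i) turns f(x_i) into the evaluation of fg at x_i; the conjugate offsets
        -- the conjugate-linear slot of the inner product.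
        set a : ι → ℂ := fun i => conj (c i / evalCLM (x i) (g : LSp 2)) with ha
        have hle : ∀ k, ‖∑ i ∈ s, (a i * (starRingEnd ℂ) (u i k)) • A.ker g (x i)‖ ≤ ‖η k‖ := fun k => by
          set T := ∑ i ∈ s, (a i * (starRingEnd ℂ) (u i k)) • A.ker g (x i) with hT
          have hTm : T ∈ A.Hg g :=
            Submodule.sum_mem _ fun i _ => Submodule.smul_mem _ _ (A.ker_mem g (x i))
          -- T and η_k induce the same functional on H_g, so T is the orthogonal projection of η_k
          -- onto H_g. Testing on T itself gives ‖T‖ ≤ ‖η_k‖.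
          have h1 := map_mem_of_mem_topologicalClosure_span
            (innerSL ℂ T - innerSL ℂ (η k)) (W := ⊥) isClosed_singleton (by
              rintro _ ⟨f, hf, rfl⟩
              rw [Submodule.mem_bot, sub_apply, innerSL_apply_apply,
                innerSL_apply_apply, ← hη f hf k, hpair f hf k, sub_eq_zero, hT, sum_inner]
              refine Finset.sum_congr rfl fun i _ => ?_
              rw [inner_smul_left, A.inner_ker g _ (lpMul_mem_cyclic hf _),
                evalCLM_lpMul (A.le_hardy hf) g.2]
              simp only [ha, map_mul, Complex.conj_conj]
              field_simp [hg0 (x i)]) hTm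
          have h3 : inner ℂ T T = inner ℂ (η k) T := sub_eq_zero.1 h1
          have h4 : ‖T‖ ^ 2 ≤ ‖η k‖ * ‖T‖ := by
            have h5 : ‖inner ℂ T T‖ = ‖T‖ ^ 2 := by
              rw [inner_self_eq_norm_sq_to_K]
              simp
            rw [← h5, h3]
            exact norm_inner_le_norm _ _
          rcases (norm_nonneg T).eq_or_lt with h6 | h6
          · rw [← h6]
            exact norm_nonneg _
          · rw [sq] at h4
            exact le_of_mul_le_mul_right h4 h6
        have hfin := h g hg s a (‖Ψ‖ + ε) (by positivity) fun q =>
          (Finset.sum_le_sum fun k _ => pow_le_pow_left₀ (norm_nonneg _) (hle k) 2).trans (hηn q)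
        -- Pairing with the unit vector g evaluates it at the nodes, and g(x_i) cancels against the
        -- denominator of a_i.
        have hsum : inner ℂ (∑ i ∈ s, (a i * conj (w i)) • A.ker g (x i))
            (g : LSp 2) = ∑ i ∈ s, c i * w i := by
          rw [sum_inner]
          refine Finset.sum_congr rfl fun i _ => ?_
          rw [inner_smul_left, A.inner_ker g _ (A.mem_Hg_self g)]
          simp only [ha, map_mul, Complex.conj_conj]
          field_simp [hg0 (x i)]
        rw [← hsum]
        refine (norm_inner_le_norm _ _).trans ?_
        have hgn : ‖(g : LSp 2)‖ = 1 := hg.2.2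
        rw [hgn, mul_one]
        exact hfin
      refine le_of_forall_pos_le_add fun ε hε' => (hε (ε / (α + 1)) (by positivity)).trans ?_
      rw [mul_add]
      gcongr
      rw [mul_div_assoc', div_le_iff₀ (by positivity)]
      nlinarith)
  obtain ⟨F, hF, hFs⟩ := A.exists_col_of_dual hΛ hΛ0
  exact ⟨F, hF, fun i => hΛw i ▸ hFs (x i) (u i)⟩

end HinfSubalg

/-! ### Columns as operators, and the two criteria -/

/-- A bounded column defines a bounded multiplication operator. -/
theorem sum_norm_sq_lpMul_le (s : Finset ℕ) (f : ℕ → LSp ⊤) (hf : ∀ k, f k ∈ hardy ⊤) (C : ℝ)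
    (hC : ∀ z : Disk, ∑ k ∈ s, ‖diskEval (f k) z‖ ^ 2 ≤ C) (h : LSp 2) :
    ∑ k ∈ s, ‖lpMul 2 (f k) h‖ ^ 2 ≤ C * ‖h‖ ^ 2 := by
  have hm : ∀ k, MemLp (f k : Circ → ℂ) 2 arc := fun k => (Lp.memLp (f k)).mono_exponent le_top
  have hcoe : ∀ k, fourierCoeff ((hm k).toLp (f k : Circ → ℂ) : Circ → ℂ) =
      fourierCoeff (f k : Circ → ℂ) := fun k => fourierCoeff_congr_ae (hm k).coeFn_toLp
  have h1 := ae_sum_le (s := s) (fun k => (hm k).toLp _)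
    (fun k n hn => by rw [hcoe]; exact hf k n hn) C
    (fun z => by simpa only [diskEval, hcoe] using hC z)
  simp only [norm_sq_eq_integral]
  rw [← integral_finsetSum _ fun k _ => integrable_norm_sq _, ← integral_const_mul]
  refine integral_mono_ae (integrable_finsetSum _ fun k _ => integrable_norm_sq _)
    ((integrable_norm_sq h).const_mul C) ?_
  filter_upwards [h1, ae_all_iff.2 fun k => (hm k).coeFn_toLp,
    ae_all_iff.2 fun k => lpMul_coe 2 (f k) h] with t h2 h3 h4
  simp only [h3] at h2
  simp only [h4, norm_mul, mul_pow]
  rw [← Finset.sum_mul]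
  gcongr

theorem hasSum_inner_ell2 (u v : ell2) :
    HasSum (fun k => (starRingEnd ℂ) (u k) * v k) (inner ℂ u v) := by
  have h := lp.hasSum_inner (𝕜 := ℂ) u v
  simp only [RCLike.inner_apply'] at h
  exact h

namespace HinfSubalg

variable (A : HinfSubalg)

theorem kernel_eq_inner (g : H2) (x y : Disk) :
    A.kernel g x y = inner ℂ (A.ker g x) (A.ker g y) := by
  rw [A.inner_ker g x (A.ker_mem g y), kernel, ← RKHS.kerFun_apply]
  rfl

variable {n : ℕ} (x : Fin n → Disk) (v : Fin n → ell2) (w : Fin n → ℂ) (g : H2)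

theorem hasSum_norm_sq_ker (c : Fin n → ℂ) :
    HasSum (fun k => ((‖∑ i, (c i * v i k) • A.ker g (x i)‖ ^ 2 : ℝ) : ℂ))
      (∑ i, ∑ j, conj (c i) * (inner ℂ (v i) (v j) * A.kernel g (x i) (x j)) * c j) := by
  have h1 : HasSum (fun k => ∑ i, ∑ j, conj (c i) *
      ((starRingEnd ℂ) (v i k) * v j k * A.kernel g (x i) (x j)) * c j)
      (∑ i, ∑ j, conj (c i) * (inner ℂ (v i) (v j) * A.kernel g (x i) (x j)) * c j) :=
    hasSum_sum fun i _ => hasSum_sum fun j _ =>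
      (((hasSum_inner_ell2 (v i) (v j)).mul_right _).mul_left _).mul_right _
  refine h1.congr_fun fun k => ?_
  have e := inner_self_eq_norm_sq_to_K (𝕜 := ℂ) (∑ i, (c i * v i k) • A.ker g (x i))
  rw [sum_inner] at e
  push_cast
  refine e.symm.trans (Finset.sum_congr rfl fun i _ => ?_)
  rw [inner_sum]
  refine Finset.sum_congr rfl fun j _ => ?_
  rw [inner_smul_left, inner_smul_right, A.kernel_eq_inner, map_mul]
  ring

theorem summable_norm_sq_ker (c : Fin n → ℂ) :
    Summable fun k => ‖∑ i, (c i * v i k) • A.ker g (x i)‖ ^ 2 :=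
  Complex.summable_ofReal.1 (A.hasSum_norm_sq_ker x v g c).summable

/-- The kernel is the Gram matrix of the kernel functions, so both terms of Q are Gram sums; the
first is spread over the coordinates of the v_i. -/
theorem Q_form (α : ℝ) (c : Fin n → ℂ) :
    ∑ i, ∑ j, conj (c i) * A.Q α x v w g i j * c j =
      ((α ^ 2 * ∑' k, ‖∑ i, (c i * v i k) • A.ker g (x i)‖ ^ 2 -
        ‖∑ i, (c i * conj (w i)) • A.ker g (x i)‖ ^ 2 : ℝ) : ℂ) := by
  have h1 := (A.hasSum_norm_sq_ker x v g c).tsum_eq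
  have e := inner_self_eq_norm_sq_to_K (𝕜 := ℂ) (∑ i, (c i * conj (w i)) • A.ker g (x i))
  rw [sum_inner] at e
  rw [Complex.ofReal_sub, Complex.ofReal_mul, Complex.ofReal_tsum, h1, Finset.mul_sum,
    Complex.ofReal_pow, Complex.ofReal_pow]
  refine Eq.trans ?_ (congrArg₂ (· - ·) rfl e)
  rw [← Finset.sum_sub_distrib]
  refine Finset.sum_congr rfl fun i _ => ?_
  rw [inner_sum, Finset.mul_sum, ← Finset.sum_sub_distrib]
  refine Finset.sum_congr rfl fun j _ => ?_
  rw [inner_smul_left, inner_smul_right, ← A.kernel_eq_inner, map_mul, Complex.conj_conj, Q,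
    Matrix.of_apply]
  ring

theorem isHermitian_Q (α : ℝ) : (A.Q α x v w g).IsHermitian := by
  ext i j
  rw [Matrix.conjTranspose_apply, Q, Matrix.of_apply, Matrix.of_apply, A.kernel_eq_inner,
    A.kernel_eq_inner, RCLike.star_def, map_mul, map_sub, map_mul, map_mul, inner_conj_symm,
    inner_conj_symm, Complex.conj_conj, map_pow, Complex.conj_ofReal, mul_comm (w i)]

theorem posSemidef_Q_iff (α : ℝ) : (A.Q α x v w g).PosSemidef ↔ ∀ c : Fin n → ℂ,
    ‖∑ i, (c i * conj (w i)) • A.ker g (x i)‖ ^ 2 ≤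
      α ^ 2 * ∑' k, ‖∑ i, (c i * v i k) • A.ker g (x i)‖ ^ 2 := by
  have e : ∀ c : Fin n →₀ ℂ, (c.sum fun i ci => c.sum fun j cj => star ci * A.Q α x v w g i j * cj) =
      ∑ i, ∑ j, conj (c i) * A.Q α x v w g i j * c j := fun c => by
    rw [Finsupp.sum_fintype _ _ fun i => by simp]
    refine Finset.sum_congr rfl fun i _ => ?_
    rw [Finsupp.sum_fintype _ _ fun i => by simp]
    rfl
  constructor
  · intro h c
    have h1 := h.2 (Finsupp.equivFunOnFinite.symm c)
    rw [e, Finsupp.coe_equivFunOnFinite_symm, Q_form, Complex.zero_le_real] at h1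
    linarith
  · refine fun h => ⟨A.isHermitian_Q x v w g α, fun c => ?_⟩
    rw [e, Q_form, Complex.zero_le_real]
    linarith [h c]

variable {A}

theorem BddSeq.norm_val_le {F : A.BddSeq} {α : ℝ} (h : (⨆ z : Disk, ‖F.val z‖) ≤ α) (z : Disk) :
    ‖F.val z‖ ≤ α := (le_ciSup F.bdd z).trans h

/-- A column that interpolates gives positive semidefinite matrices. -/
theorem posSemidef_Q_of_col {α : ℝ} (hα : 0 ≤ α) {F : A.Col} (hF : ∀ z, ‖F.val z‖ ≤ α)
    (hw : ∀ j, inner ℂ (F.val (x j)) (v j) = conj (w j)) : (A.Q α x v w g).PosSemidef := by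
  rw [posSemidef_Q_iff]
  intro c
  set u := ∑ i, (c i * conj (w i)) • A.ker g (x i) with hu
  have hum : u ∈ A.Hg g :=
    Submodule.sum_mem _ fun i _ => Submodule.smul_mem _ _ (A.ker_mem g (x i))
  set T : ℕ → LSp 2 := fun k => ∑ i, (c i * v i k) • A.ker g (x i) with hT
  have hTs : Summable fun k => ‖T k‖ ^ 2 := A.summable_norm_sq_ker x v g c
  set S := ∑' k, ‖T k‖ ^ 2 with hS
  have hS0 : 0 ≤ S := tsum_nonneg fun k => by positivity
  have hcol : ∀ s : Finset ℕ, ∑ k ∈ s, ‖lpMul 2 (F.comp k) u‖ ^ 2 ≤ α ^ 2 * ‖u‖ ^ 2 := fun s =>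
    sum_norm_sq_lpMul_le s F.comp (fun k => A.le_hardy (F.mem k)) _ (fun z =>
      (sum_norm_sq_le_ell2 s (F.val z)).trans (by gcongr; exact hF z)) u
  -- In operator terms u = Σ_k M_{f_k}* T_k: the adjoint of multiplication by f_k scales the kernel
  -- function at x_i by conj(f_k(x_i)), and the interpolation condition sums these factors to
  -- conj(w_i).
  have hsum : HasSum (fun k => inner ℂ (T k) (lpMul 2 (F.comp k) u)) (inner ℂ u u) := by
    have h1 : HasSum (fun k => ∑ i, conj (c i) * ((starRingEnd ℂ) (v i k) * F.val (x i) k) *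
        evalCLM (x i) u) (∑ i, conj (c i) * inner ℂ (v i) (F.val (x i)) * evalCLM (x i) u) :=
      hasSum_sum fun i _ => ((hasSum_inner_ell2 (v i) (F.val (x i))).mul_left _).mul_right _
    have e : inner ℂ u u = ∑ i, conj (c i) * inner ℂ (v i) (F.val (x i)) * evalCLM (x i) u := by
      conv_lhs => rw [hu]
      rw [← hu, sum_inner]
      refine Finset.sum_congr rfl fun i _ => ?_
      rw [inner_smul_left, A.inner_ker g _ hum, ← inner_conj_symm (v i), hw, map_mul]
    rw [e]
    refine h1.congr_fun fun k => ?_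
    rw [hT]
    simp only
    rw [sum_inner]
    refine Finset.sum_congr rfl fun i _ => ?_
    rw [inner_smul_left, A.inner_ker g _ (A.lpMul_mem_Hg g (F.mem k) hum),
      evalCLM_lpMul (A.le_hardy (F.mem k))
        (cyclic_le_hardy A.le_hardy g.2 hum), map_mul]
    change _ = _ * (_ * diskEval (F.comp k) (x i)) * _
    ring
  have hle : ‖inner ℂ u u‖ ≤ √S * (α * ‖u‖) := by
    refine le_of_tendsto hsum.norm (Filter.Eventually.of_forall fun s => ?_)
    calc ‖∑ k ∈ s, inner ℂ (T k) (lpMul 2 (F.comp k) u)‖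
        ≤ ∑ k ∈ s, ‖T k‖ * ‖lpMul 2 (F.comp k) u‖ :=
          (norm_sum_le _ _).trans (Finset.sum_le_sum fun k _ => norm_inner_le_norm _ _)
      _ ≤ √(∑ k ∈ s, ‖T k‖ ^ 2) * √(∑ k ∈ s, ‖lpMul 2 (F.comp k) u‖ ^ 2) :=
          Real.sum_mul_le_sqrt_mul_sqrt _ _ _
      _ ≤ √S * √((α * ‖u‖) ^ 2) := by
          gcongr
          · exact hTs.sum_le_tsum s fun k _ => by positivity
          · rw [mul_pow]
            exact hcol s
      _ = √S * (α * ‖u‖) := by rw [Real.sqrt_sq (by positivity)]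
  rw [inner_self_eq_norm_sq_to_K] at hle
  have h2 : ‖u‖ ^ 2 ≤ √S * (α * ‖u‖) := by simpa using hle
  have h3 : ‖u‖ ≤ α * √S := by
    rcases (norm_nonneg u).eq_or_lt with h6 | h6
    · rw [← h6]
      positivity
    · refine le_of_mul_le_mul_right ?_ h6
      linarith [sq ‖u‖]
  calc ‖u‖ ^ 2 ≤ (α * √S) ^ 2 := by gcongr
    _ = α ^ 2 * S := by rw [mul_pow, Real.sq_sqrt hS0]

/-- Positive semidefinite matrices give a column that interpolates. -/
theorem exists_col_of_posSemidef_Q {α : ℝ} (hα : 0 ≤ α)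
    (h : ∀ g, A.Admissible g → (A.Q α x v w g).PosSemidef) :
    ∃ F : A.Col, (⨆ z : Disk, ‖F.val z‖) ≤ α ∧
      ∀ j, inner ℂ (F.val (x j)) (v j) = conj (w j) := by
  -- The condition ⟨v_j, F(x_j)⟩ = conj(w_j) is conjugated into Σ_k conj(v_j(k)) f_k(x_j) = w_j,
  -- hence the `star`.
  obtain ⟨F, hF, hFs⟩ := A.exists_col_of_ker_bound x (fun i => star (v i)) w hα
    (fun g hg s a C hC hq => by
      classical
      set c : Fin n → ℂ := fun i => if i ∈ s then a i else 0 with hc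
      have hr : ∀ b : Fin n → ℂ, ∑ i ∈ s, (a i * b i) • A.ker g (x i) =
          ∑ i, (c i * b i) • A.ker g (x i) := fun b => by
        rw [← Finset.sum_subset (Finset.subset_univ s)]
        · refine Finset.sum_congr rfl fun i hi => ?_
          simp only [hc, if_pos hi]
        · intro i _ hi
          simp only [hc, if_neg hi, zero_mul, zero_smul]
      have hq' : ∀ q : Finset ℕ, ∑ k ∈ q, ‖∑ i, (c i * v i k) • A.ker g (x i)‖ ^ 2 ≤ C ^ 2 :=
        fun q => by
          refine le_of_eq_of_le (Finset.sum_congr rfl fun k _ => ?_) (hq q)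
          rw [← hr fun i => v i k]
          simp
      have h1 := (A.posSemidef_Q_iff x v w g α).1 (h g hg) c
      rw [hr fun i => conj (w i)]
      refine le_of_sq_le_sq (h1.trans ?_) (by positivity)
      rw [mul_pow]
      gcongr
      exact (A.summable_norm_sq_ker x v g c).tsum_le_of_sum_le hq')
  refine ⟨F, hF, fun j => ?_⟩
  rw [← (hFs j).tsum_eq, lp.inner_eq_tsum, Complex.conj_tsum]
  refine tsum_congr fun k => ?_
  simp [RCLike.inner_apply]

end HinfSubalg

/-- The operator inequality is tested on y, using ⟨M M* y, y⟩ = ‖M* y‖². -/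
theorem mul_norm_le_norm_adjoint_of_le {E F : Type*} [NormedAddCommGroup E]
    [InnerProductSpace ℂ E] [CompleteSpace E] [NormedAddCommGroup F] [InnerProductSpace ℂ F]
    [CompleteSpace F] {M : F →L[ℂ] E} {δ : ℝ}
    (h : ((δ : ℂ) ^ 2) • ContinuousLinearMap.id ℂ E ≤ M.comp (ContinuousLinearMap.adjoint M))
    (y : E) : δ * ‖y‖ ≤ ‖ContinuousLinearMap.adjoint M y‖ := by
  have h1 := ((ContinuousLinearMap.le_def _ _).1 h).re_inner_nonneg_left y
  rw [sub_apply, inner_sub_left, ContinuousLinearMap.comp_apply,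
    ← ContinuousLinearMap.adjoint_inner_right, smul_apply, ContinuousLinearMap.id_apply,
    inner_smul_left, inner_self_eq_norm_sq_to_K, inner_self_eq_norm_sq_to_K, map_pow,
    Complex.conj_ofReal] at h1
  refine le_of_sq_le_sq ?_ (norm_nonneg _)
  rw [mul_pow]
  have h2 : (0 : ℝ) ≤ ‖ContinuousLinearMap.adjoint M y‖ ^ 2 - δ ^ 2 * ‖y‖ ^ 2 := by
    refine h1.trans_eq ?_
    change Complex.re ((‖ContinuousLinearMap.adjoint M y‖ : ℂ) ^ 2 -
      (δ : ℂ) ^ 2 * (‖y‖ : ℂ) ^ 2) = _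
    norm_cast
  linarith

/-! ### Adjoints of row operators and the Toeplitz corona theorem. -/

namespace HinfSubalg

variable {A : HinfSubalg}

theorem rowOp_single (F : A.Row) (g : H2) (k : ℕ) (y : A.Hg g) :
    rowOp F g (lp.single 2 k y) = A.mulHg g (F.comp k) (F.mem k) y := by
  change ∑' j, A.mulHg g (F.comp j) (F.mem j) ((lp.single 2 k y : A.HgTensor g) j) = _
  rw [tsum_eq_single k]
  · rw [lp.single_apply_self]
  · intro j hj
    rw [lp.single_apply_ne _ _ _ hj, map_zero]

/-- The adjoint of the row operator multiplies kernel functions by the conjugate values of the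
row. -/
theorem adjoint_rowOp_ker (F : A.Row) (g : H2) (s : Finset Disk) (a : Disk → ℂ) {h : A.Hg g}
    (hh : (h : LSp 2) = ∑ z ∈ s, a z • A.ker g z) (k : ℕ) :
    ((ContinuousLinearMap.adjoint (rowOp F g) h k : A.Hg g) : LSp 2) =
      ∑ z ∈ s, (a z * (starRingEnd ℂ) (F.val z k)) • A.ker g z := by
  set T := ∑ z ∈ s, (a z * (starRingEnd ℂ) (F.val z k)) • A.ker g z with hT
  have hTm : T ∈ A.Hg g :=
    Submodule.sum_mem _ fun z _ => Submodule.smul_mem _ _ (A.ker_mem g z)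
  have key : ∀ y : A.Hg g, inner ℂ ((ContinuousLinearMap.adjoint (rowOp F g) h k : A.Hg g) : LSp 2)
      (y : LSp 2) = inner ℂ T (y : LSp 2) := fun y => by
    -- Testing on a vector supported in slot k isolates the k-th coordinate of the adjoint.
    have h1 := ContinuousLinearMap.adjoint_inner_left (rowOp F g) (lp.single 2 k y) h
    rw [lp.inner_single_right, rowOp_single] at h1
    refine Eq.trans h1 ?_
    change inner ℂ (h : LSp 2) (lpMul 2 (F.comp k) y) = _
    rw [hh, hT, sum_inner, sum_inner]
    refine Finset.sum_congr rfl fun z _ => ?_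
    rw [inner_smul_left, inner_smul_left, A.inner_ker g _ y.2,
      A.inner_ker g _ (A.lpMul_mem_Hg g (F.mem k) y.2),
      evalCLM_lpMul (A.le_hardy (F.mem k)) (cyclic_le_hardy A.le_hardy g.2 y.2), map_mul,
      Complex.conj_conj]
    change _ = _ * diskEval (F.comp k) z * _
    ring
  have h2 := key (ContinuousLinearMap.adjoint (rowOp F g) h k - ⟨T, hTm⟩)
  rw [← sub_eq_zero, ← inner_sub_left] at h2
  exact sub_eq_zero.1 (inner_self_eq_zero.1 h2)

/-- The Toeplitz corona theorem for the family of spaces `H_g`. -/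
theorem exists_right_inverse (F : A.Row) {δ : ℝ} (hδ : 0 < δ)
    (h : ∀ g : H2, A.Admissible g → ((δ : ℂ) ^ 2) • ContinuousLinearMap.id ℂ (A.Hg g) ≤
      (rowOp F g).comp (ContinuousLinearMap.adjoint (rowOp F g))) :
    ∃ G : A.Col, (∀ z : Disk, HasSum (fun k => F.val z k * G.val z k) 1) ∧
      (⨆ z : Disk, ‖G.val z‖) ≤ δ⁻¹ := by
  -- All points of the disk serve as nodes at once, so FG = 1 holds everywhere without a limit over
  -- finite sets.
  obtain ⟨G, hG, hGs⟩ := A.exists_col_of_ker_bound (fun z : Disk => z) F.val (fun _ => 1)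
    (inv_nonneg.2 hδ.le) (fun g hg s a C hC hq => by
      simp only [map_one, mul_one]
      set y : A.Hg g := ⟨∑ z ∈ s, a z • A.ker g z, Submodule.sum_mem _ fun z _ =>
        Submodule.smul_mem _ _ (A.ker_mem g z)⟩ with hy
      change ‖y‖ ≤ _
      set M := rowOp F g
      have h1 : ‖ContinuousLinearMap.adjoint M y‖ ≤ C := by
        refine lp.norm_le_of_forall_sum_le (p := 2) (by norm_num) hC fun q => ?_
        have h2 := hq q
        simp only [← adjoint_rowOp_ker F g s a (h := y) rfl] at h2
        simpa using h2
      have h6 := mul_norm_le_norm_adjoint_of_le (h g hg) y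
      rw [inv_mul_eq_div, le_div_iff₀ hδ]
      linarith)
  exact ⟨G, hGs, hG⟩

end HinfSubalg

end

theorem corollary1p2 (A : HinfSubalg) :
    (∀ (n : ℕ) (x : Fin n → Disk) (v : Fin n → ell2) (w : Fin n → ℂ) (α : ℝ), 0 ≤ α →
      ((∃ F : A.Col, (⨆ z : Disk, ‖F.val z‖) ≤ α ∧
          ∀ j, inner ℂ (F.val (x j)) (v j) = (starRingEnd ℂ) (w j)) ↔
        ∀ g : H2, A.Admissible g → (A.Q α x v w g).PosSemidef)) ∧
    (∀ (F : A.Row) (δ : ℝ), 0 < δ →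
      (∀ g : H2, A.Admissible g →
        ((δ : ℂ) ^ 2) • ContinuousLinearMap.id ℂ (A.Hg g) ≤
          (HinfSubalg.rowOp F g).comp (ContinuousLinearMap.adjoint (HinfSubalg.rowOp F g))) →
      ∃ G : A.Col, (∀ z : Disk, HasSum (fun k => F.val z k * G.val z k) 1) ∧
        (⨆ z : Disk, ‖G.val z‖) ≤ δ⁻¹) := by
  refine ⟨fun n x v w α hα => ⟨?_, HinfSubalg.exists_col_of_posSemidef_Q x v w hα⟩,
    fun F δ hδ h => HinfSubalg.exists_right_inverse F hδ h⟩
  rintro ⟨F, hF, hw⟩ g -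
  exact HinfSubalg.posSemidef_Q_of_col x v w g hα (HinfSubalg.BddSeq.norm_val_le hF) hw
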